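/- Let $S^1=\mathbb R/\mathbb Z$ with projection $\pi:\mathbb R\to S^1$ and its arc-length metric $|\cdot-\cdot|$, let $\mathcal H=\mathrm{Homeo}_+(S^1)$ be the group of orientation preserving homeomorphisms of $S^1$, with $d(f,h)=\sup_{x\in S^1}|f(x)-h(x)|$. For a group $G$ (arbitrary, with no topology), let $\mathcal R_G=\mathrm{Hom}(G,\mathcal H)$ be the set of all homomorphisms $G\to\mathcal H$, with the weak topology, i.e. the topology with subbase the sets $U(\varphi;g,\varepsilon)=\{\varphi'\in\mathcal R_G : d(\varphi'(g),\varphi(g))<\varepsilon\}$ for $\varphi\in\mathcal R_G$, $g\in G$, $\varepsilon>0$. A map $h:S^1\to S^1$ (not necessarily continuous) is degree one monotone if there is a nondecreasing $\tilde h:\mathbb R\to\mathbb R$ with $\tilde h(x+1)=\tilde h(x)+1$ and $\pi\circ\tilde h=h\circ\pi$. Homomorphisms $\varphi^1,\varphi^2\in\mathcal R_G$ are semiconjugate if either both actions have a global fixed point, or neither has one and there is a degree one monotone map $h$ with $\varphi^2(g)\circ h=h\circ\varphi^1(g)$ for all $g\in G$. (This is an equivalence relation.) A homomorphism $\varphi\in\mathcal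 R_G$ is of type $0$ if there is a $\varphi(G)$-invariant Borel probability measure on $S^1$. If $\varphi$ is not of type $0$, a minimal model of $\varphi$ is a homomorphism $\varphi_\sharp\in\mathcal R_G$ that is semiconjugate to $\varphi$ and minimal (every orbit is dense in $S^1$). For an integer $k\ge1$, $\psi\in\mathcal R_G$ is a $k$-fold lift of $\varphi\in\mathcal R_G$ if $\varphi(g)\circ\pi_k=\pi_k\circ\psi(g)$ for all $g\in G$, where $\pi_k(x)=kx$ on $S^1$. For $k\ge1$, $\varphi$ is of type $k$ if it is not of type $0$ and $k$ is the largest positive integer such that some minimal model of $\varphi$ is a $k$-fold lift of some homomorphism in $\mathcal R_G$. Let $\mathcal R_G(k)$ be the set of homomorphisms of type $k$, $k\ge0$. Then for every group $G$ and every integer $k\ge1$, the set $\mathcal R_G(0)$ is closed in $\mathcal R_G$, and $\bigcup_{1\le i\le k}\mathcal R_G(i)$ is open in $\mathcal R_G$. -/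

import Mathlib

namespace CircleAction

/-- The group of orientation preserving homeomorphisms of the circle `ℝ / ℤ`: those
homeomorphisms that lift to an increasing bijection of `ℝ` commuting with `x ↦ x + 1`
(a unit of the monoid `CircleDeg1Lift` of such nondecreasing maps). -/
def HomeoPlus : Subgroup (UnitAddCircle ≃ₜ UnitAddCircle) where
  carrier := {f | ∃ F : CircleDeg1Liftˣ, ∀ x : ℝ,
    (((F : CircleDeg1Lift) x : ℝ) : UnitAddCircle) = f (x : UnitAddCircle)}
  one_mem' := ⟨1, fun x => by simp⟩
  mul_mem' := by
    rintro f g ⟨F, hF⟩ ⟨K, hK⟩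
    refine ⟨F * K, fun x => ?_⟩
    rw [Units.val_mul, CircleDeg1Lift.mul_apply, hF, hK]
    rfl
  inv_mem' := by
    rintro f ⟨F, hF⟩
    refine ⟨F⁻¹, fun x => ?_⟩
    apply f.injective
    rw [← hF, CircleDeg1Lift.units_apply_inv_apply]
    exact (f.apply_symm_apply _).symm

/-- The uniform distance `sup_x |f x - h x|` on `HomeoPlus`. -/
noncomputable def unifDist (f h : HomeoPlus) : ℝ :=
  ⨆ x : UnitAddCircle, dist (f.1 x) (h.1 x)

/-- The set of homomorphisms from `G` to the orientation preserving homeomorphisms of the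
circle. -/
abbrev Rep (G : Type*) [Group G] := G →* HomeoPlus

section

variable {G : Type*} [Group G]

/-- The action on the circle defined by a homomorphism. -/
def act (φ : Rep G) (g : G) (x : UnitAddCircle) : UnitAddCircle := (φ g).1 x

/-- The subbasic set `U(φ; g, ε)`. -/
def subbasic (φ : Rep G) (g : G) (ε : ℝ) : Set (Rep G) :=
  {φ' | unifDist (φ' g) (φ g) < ε}

/-- The weak topology on the space of homomorphisms. -/
instance weakTopology : TopologicalSpace (Rep G) :=
  TopologicalSpace.generateFrom
    {U | ∃ (φ : Rep G) (g : G) (ε : ℝ), 0 < ε ∧ U = subbasic φ g ε}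

/-- A (not necessarily continuous) self-map of the circle is degree one monotone if it lifts to a
nondecreasing self-map of `ℝ` commuting with `x ↦ x + 1`. -/
def IsDegreeOneMonotone (h : UnitAddCircle → UnitAddCircle) : Prop :=
  ∃ H : ℝ → ℝ, Monotone H ∧ (∀ x, H (x + 1) = H x + 1) ∧
    ∀ x : ℝ, ((H x : ℝ) : UnitAddCircle) = h (x : UnitAddCircle)

/-- The action has a global fixed point. -/
def HasGlobalFixedPoint (φ : Rep G) : Prop :=
  ∃ x : UnitAddCircle, ∀ g, act φ g x = x

/-- Semiconjugacy of homomorphisms. -/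
def Semiconjugate (φ₁ φ₂ : Rep G) : Prop :=
  (HasGlobalFixedPoint φ₁ ∧ HasGlobalFixedPoint φ₂) ∨
  (¬ HasGlobalFixedPoint φ₁ ∧ ¬ HasGlobalFixedPoint φ₂ ∧
    ∃ h : UnitAddCircle → UnitAddCircle, IsDegreeOneMonotone h ∧
      ∀ g, act φ₂ g ∘ h = h ∘ act φ₁ g)

/-- Type `0`: there is an invariant Borel probability measure. -/
def IsTypeZero (φ : Rep G) : Prop :=
  ∃ μ : MeasureTheory.Measure UnitAddCircle, MeasureTheory.IsProbabilityMeasure μ ∧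
    ∀ g, μ.map (act φ g) = μ

/-- The action is minimal: every orbit is dense. -/
def IsMinimal (φ : Rep G) : Prop :=
  ∀ x : UnitAddCircle, Dense (Set.range fun g => act φ g x)

/-- `φm` is a minimal model of `φ` (this is used for `φ` not of type `0`). -/
def IsMinimalModel (φm φ : Rep G) : Prop :=
  IsMinimal φm ∧ Semiconjugate φ φm

/-- `ψ` is a `k`-fold lift of `φ`, with respect to the `k`-fold covering `x ↦ k x` of the
circle. -/
def IsFoldLift (k : ℕ) (ψ φ : Rep G) : Prop :=
  ∀ (g : G) (x : UnitAddCircle), act φ g (k • x) = k • act ψ g x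

/-- Some minimal model of `φ` is a `k`-fold lift of some homomorphism. Minimal models are unique
only up to conjugacy, and conjugating need not preserve the property of being a `k`-fold lift, so
the minimal model is quantified existentially. -/
def HasFoldModel (k : ℕ) (φ : Rep G) : Prop :=
  ∃ φm : Rep G, IsMinimalModel φm φ ∧ ∃ φ₀ : Rep G, IsFoldLift k φm φ₀

/-- Type `k`, for positive `k`: not type `0`, and `k` is the largest positive integer such that
some minimal model is a `k`-fold lift. -/
def IsTypePos (k : ℕ) (φ : Rep G) : Prop :=
  ¬ IsTypeZero φ ∧ IsGreatest {j : ℕ | 1 ≤ j ∧ HasFoldModel j φ} k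

end

/-- The set of homomorphisms of type `k`, for `k ≥ 0`. -/
def typeSet (G : Type*) [Group G] : ℕ → Set (Rep G)
  | 0 => {φ | IsTypeZero φ}
  | k + 1 => {φ | IsTypePos (k + 1) φ}

end CircleAction

namespace CircleAction

open Filter Topology MeasureTheory Set

/-! Both claims are closedness statements. A minimal model exists outside type 0
(`hasFoldModel_one`), so the type of such an action is the largest `j` with a `j`-fold model. The
union of the types `1, ..., k` is therefore the complement of the set where the type is 0 or some `j
> k` has a `j`-fold model (`iUnion_typeSet_eq`). Closedness is tested on an ultrafilter converging
to `φ`. The compactness used is that of monotone degree one maps under pointwise convergence.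

Type 0: the distribution function `H` of an invariant measure satisfies `H ∘ F = H + c` for every
lift `F`. In a limit this survives only as inequalities between `x` and `y` with `x < y`, but
passing to right limits restores the equation, and the Stieltjes measure is invariant
(`isTypeZero_of_monotone`).

Models of unbounded multiplicity: a lift commuting with translation by `1/j` has displacement
oscillating by at most `1/j`. A semiconjugacy to such lifts thus behaves like a distribution
function up to error `1/j`, and if `j` tends to infinity the limit is of type 0
(`isTypeZero_of_tendsto`).

Models of bounded multiplicity: `j` is constant along the ultrafilter. The translation by `1/j` of
the model pulls back to a monotone map `θ` commuting with the action, with a point that advances by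
one in `j` steps. A limit of such maps still commutes weakly with `φ`. If `φ` is not of type 0, it
induces on a minimal model a continuous map `T` commuting exactly with the action
(`exists_induced`). By minimality every point advances by one under the `j`-th iterate of `T`, so
averaging conjugates `T` to translation by `1/j`, and the conjugated model is a `j`-fold lift
(`hasFoldModel_of_eventually`). -/

/-- `F` is a lift of the self-map `f` of the circle. -/
def IsLift (F : ℝ → ℝ) (f : UnitAddCircle → UnitAddCircle) : Prop :=
  ∀ x : ℝ, ((F x : ℝ) : UnitAddCircle) = f (x : UnitAddCircle)

lemma coe_eq_coe_iff {x y : ℝ} : (x : UnitAddCircle) = y ↔ ∃ n : ℤ, x = y + n := by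
  rw [← sub_eq_zero, ← AddCircle.coe_sub, AddCircle.coe_eq_zero_iff]
  constructor
  · rintro ⟨n, hn⟩
    exact ⟨n, by rw [zsmul_eq_mul, mul_one] at hn; linarith⟩
  · rintro ⟨n, hn⟩
    exact ⟨n, by rw [zsmul_eq_mul, mul_one]; linarith⟩

@[simp] lemma coe_add_int (x : ℝ) (n : ℤ) : ((x + n : ℝ) : UnitAddCircle) = x :=
  coe_eq_coe_iff.2 ⟨n, rfl⟩

lemma coe_surj (p : UnitAddCircle) : ∃ x : ℝ, (x : UnitAddCircle) = p :=
  QuotientAddGroup.mk_surjective p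

/-- A continuous integer valued function on the line is constant. -/
lemma exists_int_of_continuous {f : ℝ → ℝ} (hf : Continuous f) (h : ∀ x, ∃ n : ℤ, f x = n) :
    ∃ n : ℤ, ∀ x, f x = n := by
  obtain ⟨n, hn⟩ := h 0
  refine ⟨n, fun x => ?_⟩
  rw [← hn]
  have : DiscreteTopology (range ((↑) : ℤ → ℝ)) :=
    (Int.isClosedEmbedding_coe_real.isEmbedding.toHomeomorph).symm.isEmbedding.discreteTopology
  exact isPreconnected_univ.constant_of_mapsTo (T := range ((↑) : ℤ → ℝ)) ⟨this⟩ hf.continuousOn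
    (fun x _ => by obtain ⟨m, hm⟩ := h x; exact ⟨m, hm.symm⟩) (mem_univ _) (mem_univ _)

lemma exists_int_of_coe_eq {f f' : ℝ → ℝ} (hf : Continuous f) (hf' : Continuous f')
    (h : ∀ x, (f x : UnitAddCircle) = f' x) : ∃ n : ℤ, ∀ x, f x = f' x + n := by
  obtain ⟨n, hn⟩ := exists_int_of_continuous (f := fun x => f x - f' x) (hf.sub hf') fun x => by
    obtain ⟨m, hm⟩ := coe_eq_coe_iff.1 (h x)
    exact ⟨m, by linarith⟩
  exact ⟨n, fun x => by linarith [hn x]⟩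

/-! ### Invertible lifts, the circle maps they define, and actions. -/

section Units

variable (F : CircleDeg1Liftˣ)

lemma unit_continuous : Continuous F :=
  (CircleDeg1Lift.toOrderIso F).continuous

lemma unit_strictMono : StrictMono F :=
  (CircleDeg1Lift.toOrderIso F).strictMono

@[simp] lemma unit_add_int (x : ℝ) (n : ℤ) : F (x + n) = F x + n :=
  CircleDeg1Lift.map_add_int _ _ _

/-- The self-map of the circle defined by a lift. -/
def circleMap (F : CircleDeg1Lift) : UnitAddCircle → UnitAddCircle :=
  Function.Periodic.lift (f := fun x : ℝ => ((F x : ℝ) : UnitAddCircle)) (c := 1)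
    (fun x => by simp)

@[simp] lemma circleMap_coe (F : CircleDeg1Lift) (x : ℝ) :
    circleMap F (x : UnitAddCircle) = ((F x : ℝ) : UnitAddCircle) := rfl

lemma continuous_circleMap {F : CircleDeg1Lift} (hF : Continuous F) :
    Continuous (circleMap F) :=
  continuous_quot_lift _ ((AddCircle.continuous_mk' 1).comp hF)

/-- The circle homeomorphism defined by an invertible lift. -/
def homeoOfUnit : HomeoPlus :=
  ⟨{ toFun := circleMap F
     invFun := circleMap (F⁻¹ : CircleDeg1Liftˣ)
     left_inv := fun p => by
      obtain ⟨x, rfl⟩ := coe_surj p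
      simp
     right_inv := fun p => by
      obtain ⟨x, rfl⟩ := coe_surj p
      simp
     continuous_toFun := continuous_circleMap (unit_continuous F)
     continuous_invFun := continuous_circleMap (unit_continuous F⁻¹) }, F, fun _ => rfl⟩

end Units

section

variable {G : Type*} [Group G]

lemma act_mul (φ : Rep G) (g h : G) (x : UnitAddCircle) :
    act φ (g * h) x = act φ g (act φ h x) := by
  simp [act]

@[simp] lemma act_one (φ : Rep G) (x : UnitAddCircle) : act φ 1 x = x := by
  simp [act]

@[simp] lemma act_inv_act (φ : Rep G) (g : G) (x : UnitAddCircle) :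
    act φ g⁻¹ (act φ g x) = x := by
  rw [← act_mul]; simp

@[simp] lemma act_act_inv (φ : Rep G) (g : G) (x : UnitAddCircle) :
    act φ g (act φ g⁻¹ x) = x := by
  rw [← act_mul]; simp

lemma continuous_act (φ : Rep G) (g : G) : Continuous (act φ g) := (φ g).1.continuous

lemma exists_lift (φ : Rep G) (g : G) : ∃ F : CircleDeg1Liftˣ, IsLift F (act φ g) := (φ g).2

lemma IsLift.inv {φ : Rep G} {g : G} {F : CircleDeg1Liftˣ} (hF : IsLift F (act φ g)) :
    IsLift (F⁻¹ : CircleDeg1Liftˣ) (act φ g⁻¹) := fun x => by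
  conv_rhs => rw [← CircleDeg1Lift.units_apply_inv_apply F x]
  rw [hF, act_inv_act]

/-- A family of circle homeomorphisms semiconjugate to an action by a surjection is an action. -/
lemma exists_rep_of_semiconj (φ : Rep G) {p : UnitAddCircle → UnitAddCircle}
    (hp : Function.Surjective p) (Φ : G → CircleDeg1Liftˣ)
    (h : ∀ g x, circleMap (Φ g) (p x) = p (act φ g x)) :
    ∃ ψ : Rep G, (∀ g, IsLift (Φ g) (act ψ g)) ∧ ∀ g x, act ψ g (p x) = p (act φ g x) := by
  refine ⟨MonoidHom.mk' (fun g => homeoOfUnit (Φ g)) fun a b => ?_, fun g x => rfl, h⟩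
  ext x
  obtain ⟨y, rfl⟩ := hp x
  change circleMap (Φ (a * b)) (p y) = circleMap (Φ a) (circleMap (Φ b) (p y))
  rw [h, h, h, act_mul]

/-- A monotone degree one map that intertwines an action with a minimal one is continuous. -/
lemma continuous_of_isMinimal {φ ψ : Rep G} (hψ : IsMinimal ψ) (H : CircleDeg1Lift)
    (h : ∀ g, ∃ F Ψ : CircleDeg1Liftˣ, IsLift F (act φ g) ∧ IsLift Ψ (act ψ g) ∧
      ∀ x, ((H (F x) : ℝ) : UnitAddCircle) = ((Ψ (H x) : ℝ) : UnitAddCircle)) :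
    Continuous H := by
  apply H.monotone.continuous_of_denseRange
  -- A monotone map with dense range is continuous, and up to integers the range of `H` contains
  -- every point over the `ψ`-orbit of `H 0`.
  have hd : Dense (((↑) : ℝ → UnitAddCircle) ⁻¹' range fun g => act ψ g (H 0 : ℝ)) :=
    (hψ _).preimage QuotientAddGroup.isOpenMap_coe
  refine hd.mono ?_
  rintro y ⟨g, hg⟩
  obtain ⟨F, Ψ, -, hΨ, hH⟩ := h g
  dsimp only at hg
  rw [← hΨ, ← hH, eq_comm, coe_eq_coe_iff] at hg
  obtain ⟨n, hn⟩ := hg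
  exact ⟨F 0 + n, by rw [CircleDeg1Lift.map_add_int, hn]⟩

lemma IsMinimal.not_hasGlobalFixedPoint {φ : Rep G} (hφ : IsMinimal φ) :
    ¬ HasGlobalFixedPoint φ := by
  rintro ⟨x, hx⟩
  have h := hφ x
  simp only [hx] at h
  have h1 : closure (range fun _ : G => x) = {x} := by simp
  rw [Dense, h1] at h
  have h2 : ((1 / 2 : ℝ) : UnitAddCircle) = ((0 : ℝ) : UnitAddCircle) :=
    (mem_singleton_iff.1 (h _)).trans (mem_singleton_iff.1 (h _)).symm
  obtain ⟨n, hn⟩ := coe_eq_coe_iff.1 h2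
  have h3 : (1 : ℝ) = ((2 * n : ℤ) : ℝ) := by push_cast; linarith
  have h4 : (1 : ℤ) = 2 * n := by exact_mod_cast h3
  omega

lemma HasGlobalFixedPoint.isTypeZero {φ : Rep G} (hφ : HasGlobalFixedPoint φ) : IsTypeZero φ := by
  obtain ⟨x, hx⟩ := hφ
  refine ⟨Measure.dirac x, inferInstance, fun g => ?_⟩
  rw [Measure.map_dirac' (continuous_act φ g).measurable, hx]

end

/-! ### Invariant measures and distribution functions. -/

/-- The representative in `[0, 1)` of a point of the circle. -/
noncomputable def angle (p : UnitAddCircle) : ℝ := AddCircle.equivIco 1 0 p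

@[simp] lemma coe_angle (p : UnitAddCircle) : ((angle p : ℝ) : UnitAddCircle) = p :=
  AddCircle.coe_equivIco

lemma angle_nonneg (p : UnitAddCircle) : 0 ≤ angle p := (AddCircle.equivIco 1 0 p).2.1

lemma angle_lt_one (p : UnitAddCircle) : angle p < 1 :=
  (AddCircle.equivIco (1 : ℝ) 0 p).2.2.trans_eq (zero_add 1)

lemma measurable_angle : Measurable angle :=
  measurable_subtype_coe.comp (AddCircle.measurableEquivIco (1 : ℝ) 0).measurable

lemma measurable_floor_sub_angle (x : ℝ) : Measurable fun p => (⌊x - angle p⌋ : ℝ) :=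
  measurable_from_top.comp (Int.measurable_floor.comp (measurable_const.sub measurable_angle))

lemma abs_floor_sub_angle_le (x : ℝ) (p : UnitAddCircle) : |(⌊x - angle p⌋ : ℝ)| ≤ |x| + 2 := by
  have h1 := Int.floor_le (x - angle p)
  have h2 := Int.lt_floor_add_one (x - angle p)
  have := angle_nonneg p
  have := angle_lt_one p
  rw [abs_le]
  constructor
  · linarith [neg_abs_le x]
  · linarith [le_abs_self x]

section

variable (μ : Measure UnitAddCircle) [IsProbabilityMeasure μ]

lemma integrable_floor_sub_angle (x : ℝ) : Integrable (fun p => (⌊x - angle p⌋ : ℝ)) μ :=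
  Integrable.of_bound (measurable_floor_sub_angle x).aestronglyMeasurable (|x| + 2)
    (ae_of_all _ fun p => abs_floor_sub_angle_le x p)

/-- The distribution function of a probability measure on the circle, as a monotone degree one map
of the line. -/
noncomputable def distribution : CircleDeg1Lift where
  toFun x := ∫ p, (⌊x - angle p⌋ : ℝ) ∂μ
  monotone' x y h := integral_mono (integrable_floor_sub_angle μ x)
    (integrable_floor_sub_angle μ y) fun p => by
      have : ⌊x - angle p⌋ ≤ ⌊y - angle p⌋ := Int.floor_mono (by linarith)
      exact Int.cast_le.2 this
  map_add_one' x := by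
    have h : ∀ p, (⌊x + 1 - angle p⌋ : ℝ) = ⌊x - angle p⌋ + 1 := fun p => by
      rw [show x + 1 - angle p = x - angle p + 1 by ring, Int.floor_add_one]
      push_cast; rfl
    simp only [h]
    rw [integral_add (integrable_floor_sub_angle μ x) (integrable_const _)]
    simp

lemma distribution_apply (x : ℝ) : distribution μ x = ∫ p, (⌊x - angle p⌋ : ℝ) ∂μ := rfl

end

/-- The floor records between which integer translates of `t` the point `x` lies, and `F` preserves
both order and integer translates. -/
lemma floor_unit_sub (F : CircleDeg1Liftˣ) (x t : ℝ) : ⌊F x - F t⌋ = ⌊x - t⌋ := by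
  rw [Int.floor_eq_iff]
  have h1 := Int.floor_le (x - t)
  have h2 := Int.lt_floor_add_one (x - t)
  constructor
  · have := (unit_strictMono F).monotone (show t + (⌊x - t⌋ : ℤ) ≤ x by linarith)
    rw [unit_add_int] at this
    linarith
  · have := (unit_strictMono F) (show x < t + ((⌊x - t⌋ + 1 : ℤ) : ℝ) by push_cast; linarith)
    rw [unit_add_int] at this
    push_cast at this
    linarith

section

variable {G : Type*} [Group G]

/-- The distribution function of an invariant measure semiconjugates the action to translations. -/
lemma exists_distribution_map_sub (φ : Rep G) (μ : Measure UnitAddCircle) [IsProbabilityMeasure μ]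
    {g : G} (h : μ.map (act φ g) = μ) {F : CircleDeg1Liftˣ} (hF : IsLift F (act φ g)) :
    ∃ c, ∀ x, distribution μ (F x) = distribution μ x + c := by
  have hm : Measurable (act φ g) := (continuous_act φ g).measurable
  have hn : ∀ p, ∃ n : ℤ, F (angle p) = angle (act φ g p) + n := fun p => by
    rw [← coe_eq_coe_iff, hF, coe_angle, coe_angle]
  choose n hn using hn
  have hk : ∀ x p, (⌊F x - angle (act φ g p)⌋ : ℝ) = ⌊x - angle p⌋ + n p := fun x p => by
    rw [← floor_unit_sub F x (angle p), hn p, ← Int.cast_add, ← Int.floor_add_intCast]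
    congr 2
    ring
  -- The chosen integers `n p` are a difference of two floor functions, which makes them measurable;
  -- their integral is the constant `c`.
  have hni : Integrable (fun p => (n p : ℝ)) μ := by
    have : (fun p => (n p : ℝ)) =
        fun p => (⌊F 0 - angle (act φ g p)⌋ : ℝ) - ⌊0 - angle p⌋ := by
      ext p; rw [hk]; ring
    rw [this]
    refine Integrable.sub ?_ (integrable_floor_sub_angle μ 0)
    have := integrable_floor_sub_angle μ (F 0)
    rw [← h] at this
    exact this.comp_measurable hm
  refine ⟨∫ p, (n p : ℝ) ∂μ, fun x => ?_⟩
  rw [distribution_apply, distribution_apply, ← integral_add (integrable_floor_sub_angle μ x) hni]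
  simp only [← hk]
  conv_lhs => rw [← h]
  rw [integral_map hm.aemeasurable (measurable_floor_sub_angle _).aestronglyMeasurable]

/-- Pointwise limits give only inequalities with a gap `x < y`; approaching from the right closes
the gap and yields an exact equation. -/
lemma rightLim_comp_unit {H : ℝ → ℝ} (hH : Monotone H) (F : CircleDeg1Liftˣ) {c : ℝ}
    (h : ∀ x y, x < y → H (F x) ≤ H y + c ∧ H x + c ≤ H (F y)) (x : ℝ) :
    Function.rightLim H (F x) = Function.rightLim H x + c := by
  have h1 : Tendsto H (𝓝[>] x) (𝓝 (Function.rightLim H x)) := hH.tendsto_rightLim x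
  have h2 : Tendsto (fun y => Function.rightLim H (F y)) (𝓝[>] x)
      (𝓝 (Function.rightLim H (F x))) := by
    have h3 : Tendsto (Function.rightLim H) (𝓝[>] (F x)) (𝓝 (Function.rightLim H (F x))) := by
      have := (hH.stieltjesFunction.right_continuous (F x))
      exact this.tendsto.mono_left (nhdsWithin_mono _ Ioi_subset_Ici_self)
    refine h3.comp (tendsto_nhdsWithin_iff.2 ⟨?_, ?_⟩)
    · exact ((unit_continuous F).tendsto x).mono_left nhdsWithin_le_nhds
    · filter_upwards [self_mem_nhdsWithin] with y hy using unit_strictMono F hy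
  apply le_antisymm
  · refine ge_of_tendsto (h1.add_const c) ?_
    filter_upwards [self_mem_nhdsWithin] with y hy
    obtain ⟨z, hz, hzy⟩ := exists_between (show x < y from hy)
    exact (hH.rightLim_le (unit_strictMono F hz)).trans (h z y hzy).1
  · refine le_of_tendsto_of_tendsto (h1.add_const c) h2 ?_
    filter_upwards [self_mem_nhdsWithin] with y hy
    have h4 : Tendsto (fun z => H (F z)) (𝓝[>] y) (𝓝 (Function.rightLim H (F y))) := by
      refine (hH.tendsto_rightLim (F y)).comp (tendsto_nhdsWithin_iff.2 ⟨?_, ?_⟩)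
      · exact ((unit_continuous F).tendsto y).mono_left nhdsWithin_le_nhds
      · filter_upwards [self_mem_nhdsWithin] with z hz using unit_strictMono F hz
    refine ge_of_tendsto h4 ?_
    filter_upwards [self_mem_nhdsWithin] with z hz using (h y z hz).2

lemma map_measure_of_stieltjes (s : StieltjesFunction ℝ) (F : CircleDeg1Liftˣ) {c : ℝ}
    (h : ∀ x, s (F x) = s x + c) : s.measure.map F = s.measure := by
  have hm : Measurable F := (unit_continuous F).measurable
  have hI : ∀ a b, s.measure.map F (Ioc a b) = s.measure (Ioc a b) := fun a b => by
    rw [Measure.map_apply hm measurableSet_Ioc]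
    have : (F : ℝ → ℝ) ⁻¹' Ioc a b =
        Ioc ((F⁻¹ : CircleDeg1Liftˣ) a) ((F⁻¹ : CircleDeg1Liftˣ) b) := by
      ext x
      have e1 := (unit_strictMono F).lt_iff_lt (a := (F⁻¹ : CircleDeg1Liftˣ) a) (b := x)
      have e2 := (unit_strictMono F).le_iff_le (a := x) (b := (F⁻¹ : CircleDeg1Liftˣ) b)
      rw [CircleDeg1Lift.units_apply_inv_apply] at e1 e2
      simp only [mem_preimage, mem_Ioc, e1, e2]
    rw [this, StieltjesFunction.measure_Ioc, StieltjesFunction.measure_Ioc]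
    have e1 := h ((F⁻¹ : CircleDeg1Liftˣ) a)
    have e2 := h ((F⁻¹ : CircleDeg1Liftˣ) b)
    rw [CircleDeg1Lift.units_apply_inv_apply] at e1 e2
    congr 1
    linarith
  symm
  exact Measure.ext_of_Ioc _ _ fun a b _ => (hI a b).symm

/-- An action is of type zero if some monotone degree one map weakly semiconjugates it to
translations. -/
lemma isTypeZero_of_monotone (φ : Rep G) (H : CircleDeg1Lift)
    (h : ∀ g, ∃ F : CircleDeg1Liftˣ, IsLift F (act φ g) ∧
      ∃ c, ∀ x y, x < y → H (F x) ≤ H y + c ∧ H x + c ≤ H (F y)) : IsTypeZero φ := by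
  set s : StieltjesFunction ℝ := H.monotone.stieltjesFunction
  have hone : ∀ x, s (x + 1) = s x + 1 := fun x => by
    have := rightLim_comp_unit H.monotone (CircleDeg1Lift.translate (Multiplicative.ofAdd 1))
      (c := 1) (fun x y hxy => by
        simp only [CircleDeg1Lift.translate_apply, CircleDeg1Lift.map_one_add]
        constructor <;> linarith [H.monotone hxy.le]) x
    rwa [CircleDeg1Lift.translate_apply, add_comm] at this
  have hint : ∀ n : ℤ, s.measure.map (fun x => (n : ℝ) + x) = s.measure := fun n => by
    have hc : ∀ x, s ((CircleDeg1Lift.translate (Multiplicative.ofAdd (n : ℝ))) x) = s x + n :=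
      fun x => by
        have := (CircleDeg1Lift.mk ⟨s, s.mono⟩ hone).map_int_add n x
        rw [CircleDeg1Lift.translate_apply, add_comm (s x)]
        exact this
    convert map_measure_of_stieltjes s _ hc using 2
    ext x
    exact (CircleDeg1Lift.translate_apply _ _).symm
  have : VAddInvariantMeasure (AddSubgroup.zmultiples (1 : ℝ)) ℝ s.measure := by
    refine ⟨fun ⟨c, n, hn⟩ t ht => ?_⟩
    have e := hint n
    conv_rhs => rw [← e]
    rw [Measure.map_apply (by fun_prop) ht]
    congr 1
    ext x
    simp only [zsmul_eq_mul, mul_one] at hn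
    subst hn
    rfl
  -- By invariance under integer translations, the measure pushed down to the circle can be computed
  -- in any unit window.
  have hfund : ∀ (t : ℝ) (B : Set UnitAddCircle), MeasurableSet B →
      s.measure (((↑) : ℝ → UnitAddCircle) ⁻¹' B ∩ Ioc t (t + 1)) =
      s.measure (((↑) : ℝ → UnitAddCircle) ⁻¹' B ∩ Ioc 0 1) := fun t B hB => by
    have f1 := isAddFundamentalDomain_Ioc (T := 1) one_pos t s.measure
    have f2 := isAddFundamentalDomain_Ioc (T := 1) one_pos 0 s.measure
    rw [zero_add] at f2
    refine f1.measure_set_eq f2 (AddCircle.measurable_mk' hB) ?_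
    rintro ⟨c, n, hn⟩
    ext x
    simp only [zsmul_eq_mul, mul_one] at hn
    subst hn
    change (((n : ℝ) + x : ℝ) : UnitAddCircle) ∈ B ↔ _
    rw [add_comm, coe_add_int]
    rfl
  refine ⟨(s.measure.restrict (Ioc 0 1)).map ((↑) : ℝ → UnitAddCircle), ?_, fun g => ?_⟩
  · refine ⟨?_⟩
    rw [Measure.map_apply AddCircle.measurable_mk' MeasurableSet.univ, preimage_univ,
      Measure.restrict_apply_univ, StieltjesFunction.measure_Ioc]
    have := hone 0
    rw [zero_add] at this
    simp [this]
  · obtain ⟨F, hF, c, hc⟩ := h g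
    have hm : Measurable (act φ g) := (continuous_act φ g).measurable
    have hFs : s.measure.map F = s.measure :=
      map_measure_of_stieltjes s F (c := c) fun x => rightLim_comp_unit H.monotone F hc x
    ext B hB
    -- On the right the window is moved to `(F 0, F 0 + 1]`, because its preimage under `F` is `(0,
    -- 1]`.
    rw [Measure.map_apply hm hB, Measure.map_apply AddCircle.measurable_mk' (hm hB),
      Measure.map_apply AddCircle.measurable_mk' hB,
      Measure.restrict_apply (AddCircle.measurable_mk' (hm hB)),
      Measure.restrict_apply (AddCircle.measurable_mk' hB), ← hfund (F 0) B hB]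
    conv_rhs => rw [← hFs]
    rw [Measure.map_apply (unit_continuous F).measurable
      ((AddCircle.measurable_mk' hB).inter measurableSet_Ioc)]
    congr 1
    ext x
    have e1 := (unit_strictMono F).lt_iff_lt (a := 0) (b := x)
    have e2 := (unit_strictMono F).le_iff_le (a := x) (b := 0 + 1)
    rw [CircleDeg1Lift.map_add_one, zero_add] at e2
    simp only [mem_inter_iff, mem_preimage, mem_Ioc, e1, e2, hF x]

end

/-! ### Atomless measures supported on perfect sets. -/

/-- An uncountable Borel set carries a probability measure without atoms. -/
lemma exists_noAtoms_measure {α : Type*} [MeasurableSpace α] [StandardBorelSpace α] {C : Set α}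
    (hC : MeasurableSet C) (hc : ¬ C.Countable) :
    ∃ μ : Measure α, IsProbabilityMeasure μ ∧ (∀ x, μ {x} = 0) ∧ μ Cᶜ = 0 := by
  have := hC.standardBorel
  let e : ℝ ≃ᵐ C := PolishSpace.measurableEquivOfNotCountable
    (by rw [← Set.countable_univ_iff]; exact not_countable_univ) hc
  have hm : Measurable fun x => (e x : α) := measurable_subtype_coe.comp e.measurable
  have hinj : Function.Injective fun x => (e x : α) := Subtype.val_injective.comp e.injective
  have : IsProbabilityMeasure (volume.restrict (Ioc (0 : ℝ) 1)) := ⟨by simp⟩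
  refine ⟨(volume.restrict (Ioc (0 : ℝ) 1)).map fun x => (e x : α),
    Measure.isProbabilityMeasure_map hm.aemeasurable, fun x => ?_, ?_⟩
  · rw [Measure.map_apply hm (measurableSet_singleton x)]
    exact (subsingleton_singleton.preimage hinj).measure_zero _
  · rw [Measure.map_apply hm hC.compl]
    convert measure_empty (μ := volume.restrict (Ioc (0 : ℝ) 1)) using 2
    ext x
    simp

lemma not_countable_of_perfect {α : Type*} [MetricSpace α] [CompleteSpace α] {C : Set α}
    (hC : Perfect C) (hne : C.Nonempty) : ¬ C.Countable := by
  intro hc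
  obtain ⟨f, hf, -, hinj⟩ := hC.exists_nat_bool_injection hne
  have h1 : (range f).Countable := hc.mono hf
  have := h1.to_subtype
  have : Countable (ℕ → Bool) := (Equiv.ofInjective f hinj).countable_iff.2 this
  obtain ⟨e, he⟩ := exists_surjective_nat (ℕ → Bool)
  obtain ⟨n, hn⟩ := he fun k => !(e k k)
  simpa using congrFun hn n

/-- A nonempty perfect set is the support of a probability measure without atoms. -/
lemma exists_noAtoms_measure_support {α : Type*} [MetricSpace α] [CompleteSpace α]
    [SecondCountableTopology α] [MeasurableSpace α] [BorelSpace α] {K : Set α} (hK : Perfect K)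
    (hne : K.Nonempty) :
    ∃ μ : Measure α, IsProbabilityMeasure μ ∧ (∀ x, μ {x} = 0) ∧ μ Kᶜ = 0 ∧
      ∀ U, IsOpen U → (U ∩ K).Nonempty → μ U ≠ 0 := by
  obtain ⟨b, hbc, -, hb⟩ := TopologicalSpace.exists_countable_basis α
  have hbne : b.Nonempty := by
    obtain ⟨x, -⟩ := hne
    obtain ⟨v, hv, -⟩ := hb.exists_subset_of_mem_open (mem_univ x) isOpen_univ
    exact ⟨v, hv⟩
  obtain ⟨u, rfl⟩ := hbc.exists_eq_range hbne
  -- Each basic open set meeting `K` gets an atomless probability measure on the closure of its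
  -- trace on `K`, which is again perfect; a weighted sum of these charges every such set.
  have key : ∀ n, ∃ μ : Measure α, IsProbabilityMeasure μ ∧ (∀ x, μ {x} = 0) ∧ μ Kᶜ = 0 ∧
      ((u n ∩ K).Nonempty → μ (closure (u n))ᶜ = 0) := fun n => by
    by_cases h : (u n ∩ K).Nonempty
    · obtain ⟨x, hxu, hxK⟩ := h
      obtain ⟨hp, hpne⟩ := hK.closure_nhds_inter x hxK hxu (hb.isOpen ⟨n, rfl⟩)
      obtain ⟨μ, hμ, ha, h0⟩ := exists_noAtoms_measure hp.closed.measurableSet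
        (not_countable_of_perfect hp hpne)
      refine ⟨μ, hμ, ha, measure_mono_null (compl_subset_compl.2 ?_) h0, fun _ =>
        measure_mono_null (compl_subset_compl.2 (closure_mono inter_subset_left)) h0⟩
      exact closure_minimal inter_subset_right hK.closed
    · obtain ⟨μ, hμ, ha, h0⟩ := exists_noAtoms_measure hK.closed.measurableSet
        (not_countable_of_perfect hK hne)
      exact ⟨μ, hμ, ha, h0, fun h' => absurd h' h⟩
  choose μ hμ ha h0 hcl using key
  refine ⟨Measure.sum fun n => ((2 : ENNReal)⁻¹ ^ (n + 1)) • μ n, ⟨?_⟩, fun x => ?_, ?_, ?_⟩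
  · rw [Measure.sum_apply _ MeasurableSet.univ]
    simp [ENNReal.tsum_geometric_add_one, ENNReal.one_sub_inv_two, ENNReal.inv_mul_cancel]
  · rw [Measure.sum_apply _ (measurableSet_singleton x)]
    simp [ha]
  · rw [Measure.sum_apply _ hK.closed.measurableSet.compl]
    simp [h0]
  · rintro U hU ⟨x, hxU, hxK⟩ hz
    obtain ⟨v, ⟨n, rfl⟩, hxn, hnU⟩ := hb.exists_closure_subset (hU.mem_nhds hxU)
    rw [Measure.sum_apply _ hU.measurableSet, ENNReal.tsum_eq_zero] at hz
    have h1 : μ n U = 0 := by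
      have := hz n
      simpa using this
    have h2 : μ n (closure (u n)) = 1 := by
      rw [← prob_compl_eq_zero_iff isClosed_closure.measurableSet]
      exact hcl n ⟨x, hxn, hxK⟩
    have h3 := measure_mono (μ := μ n) hnU
    rw [h1, h2] at h3
    simp at h3

section

variable (μ : Measure UnitAddCircle) [IsProbabilityMeasure μ]

lemma eventually_floor_sub_eq {x t : ℝ} (h : (x : UnitAddCircle) ≠ t) :
    ∀ᶠ y in 𝓝 x, ⌊y - t⌋ = ⌊x - t⌋ := by
  have h1 : (⌊x - t⌋ : ℝ) < x - t := lt_of_le_of_ne (Int.floor_le _) fun h' =>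
    h (coe_eq_coe_iff.2 ⟨⌊x - t⌋, by linarith⟩)
  have h2 := Int.lt_floor_add_one (x - t)
  filter_upwards [Ioo_mem_nhds (show (⌊x - t⌋ : ℝ) + t < x by linarith)
    (show x < ⌊x - t⌋ + 1 + t by linarith)] with y hy
  rw [Int.floor_eq_iff]
  constructor <;> linarith [hy.1, hy.2]

lemma continuous_distribution (h : ∀ x, μ {x} = 0) : Continuous (distribution μ) := by
  rw [continuous_iff_continuousAt]
  intro x
  change ContinuousAt (fun x => ∫ p, (⌊x - angle p⌋ : ℝ) ∂μ) x
  refine continuousAt_of_dominated (bound := fun _ => |x| + 3)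
    (Eventually.of_forall fun y => (measurable_floor_sub_angle y).aestronglyMeasurable) ?_
    (integrable_const _) ?_
  · filter_upwards [Metric.ball_mem_nhds x one_pos] with y hy
    refine ae_of_all _ fun p => (abs_floor_sub_angle_le y p).trans ?_
    rw [Metric.mem_ball, Real.dist_eq] at hy
    have := abs_sub_abs_le_abs_sub y x
    linarith
  · have : ∀ᵐ p ∂μ, p ≠ (x : UnitAddCircle) := by
      rw [ae_iff]; simpa using h x
    filter_upwards [this] with p hp
    have he : ∀ᶠ y in 𝓝 x, ⌊y - angle p⌋ = ⌊x - angle p⌋ :=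
      eventually_floor_sub_eq (by simpa using hp.symm)
    exact (continuousAt_const (y := (⌊x - angle p⌋ : ℝ))).congr
      (he.mono fun y hy => by simp [hy])

/-- The increment of the distribution function is the mass of the arc, counted with multiplicity,
and atomless measures ignore endpoints. So the plateaus are exactly the closures of gaps of `K`. -/
lemma distribution_eq_iff {K : Set UnitAddCircle} (h : ∀ x, μ {x} = 0) (hK : μ Kᶜ = 0)
    (hU : ∀ U, IsOpen U → (U ∩ K).Nonempty → μ U ≠ 0) {a b : ℝ} (hab : a < b) :
    distribution μ a = distribution μ b ↔ ∀ t ∈ Ioo a b, (t : UnitAddCircle) ∉ K := by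
  constructor
  · intro he t ht htK
    have hle : ∀ p, (⌊a - angle p⌋ : ℝ) ≤ ⌊b - angle p⌋ := fun p =>
      Int.cast_le.2 (Int.floor_mono (by linarith))
    have hae := (integral_eq_iff_of_ae_le (integrable_floor_sub_angle μ a)
      (integrable_floor_sub_angle μ b) (ae_of_all _ hle)).1 he
    refine hU (((↑) : ℝ → UnitAddCircle) '' Ioo a b)
      (QuotientAddGroup.isOpenMap_coe _ isOpen_Ioo) ⟨t, mem_image_of_mem _ ht, htK⟩ ?_
    refine measure_mono_null ?_ hae
    rintro p ⟨s, hs, rfl⟩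
    obtain ⟨n, hn⟩ := coe_eq_coe_iff.1 (coe_angle (s : UnitAddCircle))
    intro h'
    replace h' : ⌊a - angle s⌋ = ⌊b - angle s⌋ := Int.cast_injective (α := ℝ) h'
    rw [hn, ← sub_sub, ← sub_sub, Int.floor_sub_intCast, Int.floor_sub_intCast] at h'
    have h1 : ⌊a - s⌋ < 0 := Int.floor_lt.2 (by push_cast; linarith [hs.1])
    have h2 : 0 ≤ ⌊b - s⌋ := Int.floor_nonneg.2 (by linarith [hs.2])
    omega
  · intro hK'
    rw [distribution_apply, distribution_apply]
    apply integral_congr_ae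
    have h1 : ∀ᵐ p ∂μ, p ≠ (b : UnitAddCircle) := by
      rw [ae_iff]; simpa using h b
    have h2 : ∀ᵐ p ∂μ, p ∈ K := hK
    filter_upwards [h1, h2] with p hp hpK
    congr 1
    refine le_antisymm (Int.floor_mono (by linarith)) (Int.le_floor.2 ?_)
    by_contra! hlt
    have hle := Int.floor_le (b - angle p)
    have hcoe : ((angle p + ⌊b - angle p⌋ : ℝ) : UnitAddCircle) = p := by simp
    rcases hle.eq_or_lt with he | hlt'
    · exact hp (by rw [← hcoe]; congr 1; linarith)
    · exact hK' (angle p + ⌊b - angle p⌋) ⟨by linarith, by linarith⟩ (by rwa [hcoe])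

end

/-! ### Minimal sets and minimal models. -/

section

variable {G : Type*} [Group G]

lemma exists_minimal_set (φ : Rep G) : ∃ K : Set UnitAddCircle, IsClosed K ∧ K.Nonempty ∧
    (∀ g, ∀ x ∈ K, act φ g x ∈ K) ∧ ∀ x ∈ K, K ⊆ closure (range fun g => act φ g x) := by
  obtain ⟨K, hK⟩ := zorn_superset
    {K : Set UnitAddCircle | IsClosed K ∧ K.Nonempty ∧ ∀ g, ∀ x ∈ K, act φ g x ∈ K} (by
      intro c hc hchain
      rcases c.eq_empty_or_nonempty with rfl | hne
      · exact ⟨univ, ⟨isClosed_univ, ⟨0, mem_univ _⟩, fun _ _ _ => mem_univ _⟩, by simp⟩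
      · refine ⟨⋂₀ c, ⟨isClosed_sInter fun s hs => (hc hs).1, ?_, fun g x hx s hs =>
          (hc hs).2.2 g x (hx s hs)⟩, fun s hs => sInter_subset_of_mem hs⟩
        have := hne.to_subtype
        exact IsCompact.nonempty_sInter_of_directed_nonempty_isCompact_isClosed
          (fun s hs t ht => (hchain.total hs ht).elim (fun h => ⟨s, hs, subset_rfl, h⟩)
            fun h => ⟨t, ht, h, subset_rfl⟩) (fun s hs => (hc hs).2.1)
          (fun s hs => (hc hs).1.isCompact) (fun s hs => (hc hs).1))
  obtain ⟨⟨hcl, hne, hinv⟩, hmin⟩ := hK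
  refine ⟨K, hcl, hne, hinv, fun x hx => hmin ⟨isClosed_closure, ⟨x, subset_closure ⟨1, by simp⟩⟩,
    fun g y hy => ?_⟩ ?_⟩
  · refine map_mem_closure (continuous_act φ g) hy ?_
    rintro _ ⟨h, rfl⟩
    exact ⟨g * h, act_mul φ g h x⟩
  · refine closure_minimal ?_ hcl
    rintro _ ⟨g, rfl⟩
    exact hinv g x hx

lemma isTypeZero_of_finite (φ : Rep G) {K : Set UnitAddCircle} (hK : K.Finite) (hne : K.Nonempty)
    (hinv : ∀ g, ∀ x ∈ K, act φ g x ∈ K) : IsTypeZero φ := by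
  refine ⟨ProbabilityTheory.uniformOn K, ProbabilityTheory.isProbabilityMeasure_uniformOn hK hne,
    fun g => ?_⟩
  have hm : Measurable (act φ g) := (continuous_act φ g).measurable
  have hinj : Function.Injective (act φ g) := (φ g).1.injective
  ext B hB
  rw [Measure.map_apply hm hB, ProbabilityTheory.uniformOn,
    ProbabilityTheory.cond_apply hK.measurableSet, ProbabilityTheory.cond_apply hK.measurableSet,
    ← Measure.count_injective_image hinj (K ∩ _)]
  congr 2
  ext y
  constructor
  · rintro ⟨x, ⟨hx, hxB⟩, rfl⟩
    exact ⟨hinv g x hx, hxB⟩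
  · rintro ⟨hy, hyB⟩
    exact ⟨act φ g⁻¹ y, ⟨hinv _ _ hy, by simpa using hyB⟩, by simp⟩

/-- An isolated point would be spread over `K` by the dense orbits, making `K` discrete and compact,
hence finite; the uniform measure on `K` would then be invariant. -/
lemma perfect_of_minimal_set {φ : Rep G} (hφ : ¬ IsTypeZero φ) {K : Set UnitAddCircle}
    (hcl : IsClosed K) (hne : K.Nonempty) (hinv : ∀ g, ∀ x ∈ K, act φ g x ∈ K)
    (hmin : ∀ x ∈ K, K ⊆ closure (range fun g => act φ g x)) : Perfect K := by
  refine ⟨hcl, ?_⟩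
  rw [preperfect_iff_nhds]
  intro x hx U hU
  by_contra! h
  apply hφ
  obtain ⟨V, hVU, hV, hxV⟩ := mem_nhds_iff.1 hU
  refine isTypeZero_of_finite φ ?_ hne hinv
  refine hcl.isCompact.finite (isDiscrete_iff_forall_mem_exists_isOpen.2 fun y hy => ?_)
  obtain ⟨_, hz, g, rfl⟩ := mem_closure_iff.1 (hmin y hy hx) V hV hxV
  refine ⟨act φ g ⁻¹' V, hV.preimage (continuous_act φ g), ?_⟩
  ext z
  constructor
  · rintro ⟨h1, h2⟩
    have e1 := h _ ⟨hVU h1, hinv g z h2⟩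
    have e2 := h _ ⟨hVU hz, hinv g y hy⟩
    exact (φ g).1.injective (e1.trans e2.symm)
  · rintro rfl
    exact ⟨hz, hy⟩

/-- A unit descends through a continuous monotone degree one map whose fibres it preserves. -/
lemma exists_unit_of_fibres {H : CircleDeg1Lift} (hs : Function.Surjective H) (F : CircleDeg1Liftˣ)
    (h : ∀ x y, H x = H y ↔ H (F x) = H (F y)) :
    ∃ Ψ : CircleDeg1Liftˣ, ∀ x, Ψ (H x) = H (F x) := by
  choose r hr using hs
  have hrx : ∀ x, H (F (r (H x))) = H (F x) := fun x => (h _ _).1 (hr _)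
  let Ψ : CircleDeg1Lift := ⟨⟨fun y => H (F (r y)), fun y z hyz => by
    rcases le_total (r y) (r z) with h' | h'
    · exact H.monotone ((unit_strictMono F).monotone h')
    · have : z ≤ y := by rw [← hr y, ← hr z]; exact H.monotone h'
      rw [le_antisymm hyz this]⟩, fun y => by
    change H (F (r (y + 1))) = H (F (r y)) + 1
    rw [← CircleDeg1Lift.map_add_one, ← CircleDeg1Lift.map_add_one]
    refine (h _ _).1 ?_
    rw [hr, CircleDeg1Lift.map_add_one, hr]⟩
  have hΨ : ∀ x, Ψ (H x) = H (F x) := hrx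
  have hb : Function.Bijective Ψ := by
    constructor
    · intro y z hyz
      have := (h _ _).2 (show H (F (r y)) = H (F (r z)) from hyz)
      rwa [hr, hr] at this
    · intro z
      refine ⟨H ((F⁻¹ : CircleDeg1Liftˣ) (r z)), ?_⟩
      rw [hΨ, CircleDeg1Lift.units_apply_inv_apply, hr]
  obtain ⟨u, hu⟩ := CircleDeg1Lift.isUnit_iff_bijective.2 hb
  exact ⟨u, fun x => by rw [hu, hΨ]⟩

/-- `H` is a lift of an equivariant map from `φ` to `ψ`. -/
def Intertwines (H : CircleDeg1Lift) (φ ψ : Rep G) : Prop :=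
  ∀ g p, act ψ g (circleMap H p) = circleMap H (act φ g p)

lemma circleMap_surjective {H : CircleDeg1Lift} (hH : Function.Surjective H) :
    Function.Surjective (circleMap H) := fun p => by
  obtain ⟨y, rfl⟩ := coe_surj p
  obtain ⟨x, rfl⟩ := hH y
  exact ⟨x, rfl⟩

lemma Intertwines.continuous {H : CircleDeg1Lift} {φ ψ : Rep G} (h : Intertwines H φ ψ)
    (hψ : IsMinimal ψ) : Continuous H :=
  continuous_of_isMinimal (φ := φ) hψ H fun g => by
    obtain ⟨F, hF⟩ := exists_lift φ g
    obtain ⟨Ψ, hΨ⟩ := exists_lift ψ g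
    refine ⟨F, Ψ, hF, hΨ, fun x => ?_⟩
    rw [← circleMap_coe H, hF, ← h, circleMap_coe, hΨ]

/-- An arbitrary lift of the action of `g` satisfies the equation up to an integer, constant by
continuity; a translation removes it. -/
lemma Intertwines.exists_lift {H : CircleDeg1Lift} {φ ψ : Rep G} (h : Intertwines H φ ψ)
    (hH : Continuous H) {g : G} {F : CircleDeg1Liftˣ} (hF : IsLift F (act φ g)) :
    ∃ Ψ : CircleDeg1Liftˣ, IsLift Ψ (act ψ g) ∧ ∀ x, Ψ (H x) = H (F x) := by
  obtain ⟨Ψ, hΨ⟩ := CircleAction.exists_lift ψ g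
  obtain ⟨n, hn⟩ := exists_int_of_coe_eq (hH.comp (unit_continuous F))
    ((unit_continuous Ψ).comp hH) fun x => by
      simp only [Function.comp]
      rw [← circleMap_coe H, hF, ← h, circleMap_coe, hΨ]
  refine ⟨CircleDeg1Lift.translate (Multiplicative.ofAdd (n : ℝ)) * Ψ, fun x => ?_, fun x => ?_⟩
  · rw [Units.val_mul, CircleDeg1Lift.mul_apply, CircleDeg1Lift.translate_apply, add_comm,
      coe_add_int, hΨ]
  · rw [Units.val_mul, CircleDeg1Lift.mul_apply, CircleDeg1Lift.translate_apply, add_comm]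
    exact (hn x).symm

lemma Intertwines.comp {H H' : CircleDeg1Lift} {φ ψ χ : Rep G} (h : Intertwines H φ ψ)
    (h' : Intertwines H' ψ χ) : Intertwines (H' * H) φ χ := fun g p => by
  have e : ∀ q, circleMap (H' * H) q = circleMap H' (circleMap H q) := fun q => by
    obtain ⟨x, rfl⟩ := coe_surj q
    rfl
  rw [e, e, h', h]

lemma IsMinimalModel.exists_intertwines {φ ψ : Rep G} (h : IsMinimalModel ψ φ) :
    ∃ H, Intertwines H φ ψ := by
  obtain ⟨hψ, ⟨-, h⟩ | ⟨-, -, h, ⟨H, hm, h1, hH⟩, hg⟩⟩ := h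
  · exact absurd h hψ.not_hasGlobalFixedPoint
  · refine ⟨⟨⟨H, hm⟩, h1⟩, fun g p => ?_⟩
    have : circleMap ⟨⟨H, hm⟩, h1⟩ = h := by
      ext p
      obtain ⟨x, rfl⟩ := coe_surj p
      exact hH x
    rw [this]
    exact congrFun (hg g) p

lemma isMinimalModel_of_intertwines {φ ψ : Rep G} (hφ : ¬ IsTypeZero φ) (hψ : IsMinimal ψ)
    {H : CircleDeg1Lift} (hH : Intertwines H φ ψ) : IsMinimalModel ψ φ :=
  ⟨hψ, Or.inr ⟨fun h => hφ h.isTypeZero, hψ.not_hasGlobalFixedPoint, circleMap H,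
    ⟨H, H.monotone, H.map_add_one, fun _ => rfl⟩, fun g => funext fun p => hH g p⟩⟩

/-- The distribution function of an atomless measure with support a minimal set `K` collapses the
gaps of `K`. The action permutes these gaps, so it descends, and density of orbits in `K` becomes
minimality. -/
lemma exists_minimal_intertwines {φ : Rep G} (hφ : ¬ IsTypeZero φ) :
    ∃ ψ : Rep G, IsMinimal ψ ∧ ∃ H, Intertwines H φ ψ := by
  obtain ⟨K, hcl, hne, hinv, hmin⟩ := exists_minimal_set φ
  obtain ⟨μ, hμ, ha, h0, hU⟩ :=
    exists_noAtoms_measure_support (perfect_of_minimal_set hφ hcl hne hinv hmin) hne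
  set H := distribution μ with hHdef
  have hH : Continuous H := continuous_distribution μ ha
  have hs : Function.Surjective H := H.continuous_iff_surjective.1 hH
  have hiff : ∀ a b, a < b → (H a = H b ↔ ∀ t ∈ Ioo a b, (t : UnitAddCircle) ∉ K) := fun a b hab =>
    distribution_eq_iff μ ha h0 hU hab
  have hone : ∀ g (F : CircleDeg1Liftˣ), IsLift F (act φ g) → ∀ a b, H a = H b →
      H (F a) = H (F b) := by
    intro g F hF
    have hlt : ∀ a b, a < b → H a = H b → H (F a) = H (F b) := by
      intro a b hab h
      rw [hiff _ _ (unit_strictMono F hab)]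
      intro t ht htK
      have e := CircleDeg1Lift.units_apply_inv_apply F t
      refine (hiff a b hab).1 h ((F⁻¹ : CircleDeg1Liftˣ) t) ?_ ?_
      · rw [← e] at ht
        exact ⟨(unit_strictMono F).lt_iff_lt.1 ht.1, (unit_strictMono F).lt_iff_lt.1 ht.2⟩
      · rw [hF.inv]
        exact hinv _ _ htK
    intro a b h
    rcases lt_trichotomy a b with hab | rfl | hab
    · exact hlt a b hab h
    · rfl
    · exact (hlt b a hab h.symm).symm
  choose F hF using exists_lift φ
  have hΨ : ∀ g, ∃ Ψ : CircleDeg1Liftˣ, ∀ x, Ψ (H x) = H (F g x) := fun g =>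
    exists_unit_of_fibres hs (F g) fun x y => ⟨hone g _ (hF g) x y, fun h => by
      have := hone g⁻¹ _ (hF g).inv _ _ h
      rwa [CircleDeg1Lift.units_inv_apply_apply, CircleDeg1Lift.units_inv_apply_apply] at this⟩
  choose Ψ hΨ using hΨ
  obtain ⟨ψ, -, hψ⟩ := exists_rep_of_semiconj φ (circleMap_surjective hs) Ψ fun g p => by
    obtain ⟨x, rfl⟩ := coe_surj p
    rw [circleMap_coe, circleMap_coe, hΨ, ← hF, circleMap_coe]
  refine ⟨ψ, fun q => ?_, H, hψ⟩
  obtain ⟨y, rfl⟩ := coe_surj q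
  -- the right end of the fibre over `y` projects to `K`
  obtain ⟨b, hb, hby⟩ : ∃ b : ℝ, (b : UnitAddCircle) ∈ K ∧ H b = y := by
    obtain ⟨x, hx⟩ := hs y
    have hbdd : BddAbove (H ⁻¹' {y}) := ⟨x + 1, fun z hz => by
      by_contra! h
      have := H.monotone h.le
      rw [H.map_add_one, hx, mem_singleton_iff.1 hz] at this
      linarith⟩
    have hmem : sSup (H ⁻¹' {y}) ∈ H ⁻¹' {y} :=
      (isClosed_singleton.preimage hH).csSup_mem ⟨x, hx⟩ hbdd
    refine ⟨sSup (H ⁻¹' {y}), ?_, hmem⟩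
    set b := sSup (H ⁻¹' {y})
    have hcK : IsClosed (((↑) : ℝ → UnitAddCircle) ⁻¹' K) :=
      hcl.preimage (AddCircle.continuous_mk' 1)
    change b ∈ ((↑) : ℝ → UnitAddCircle) ⁻¹' K
    rw [← hcK.closure_eq, Metric.mem_closure_iff]
    intro ε hε
    -- Since `b` is the last point of its fibre, `H` increases immediately to its right, so `K` has
    -- points there arbitrarily close to `b`.
    have hne' : H b ≠ H (b + ε) := fun h => by
      have := le_csSup hbdd (show b + ε ∈ H ⁻¹' {y} from h.symm.trans hmem)
      linarith
    rw [Ne, hiff _ _ (by linarith)] at hne'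
    push Not at hne'
    obtain ⟨t, ht, htK⟩ := hne'
    refine ⟨t, htK, ?_⟩
    rw [Real.dist_eq, abs_sub_comm, abs_lt]
    constructor <;> linarith [ht.1, ht.2]
  rw [dense_iff_inter_open]
  rintro U hUo ⟨z, hz⟩
  obtain ⟨z, rfl⟩ := circleMap_surjective hs z
  obtain ⟨z, rfl⟩ := coe_surj z
  have hV : IsOpen (((↑) : ℝ → UnitAddCircle) ⁻¹' U) := hUo.preimage (AddCircle.continuous_mk' 1)
  obtain ⟨ε, hε, hεU⟩ := Metric.isOpen_iff.1 hV (H z) hz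
  obtain ⟨w, hw⟩ := hs (H z + ε / 2)
  have hzw : z < w := by
    by_contra! h
    have := H.monotone h
    linarith
  have hne' : ¬ H z = H w := by rw [hw]; linarith
  rw [hiff _ _ hzw] at hne'
  push Not at hne'
  obtain ⟨t, ht, htK⟩ := hne'
  have htU : circleMap H t ∈ U := by
    refine hεU ?_
    rw [Metric.mem_ball, Real.dist_eq, abs_lt]
    constructor <;> linarith [H.monotone ht.1.le, H.monotone ht.2.le]
  obtain ⟨_, hg, g, rfl⟩ := mem_closure_iff.1 (hmin b hb htK) _
    (hUo.preimage (continuous_circleMap hH)) htU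
  refine ⟨_, hg, g, ?_⟩
  dsimp only
  rw [← hby, ← circleMap_coe, hψ]

end

/-! ### Fold lifts, translation by `1/k`, and approximate invariance. -/

section

lemma abs_displacement_sub_le (F : CircleDeg1Lift) (x y : ℝ) :
    |(F x - x) - (F y - y)| ≤ 1 := by
  have h1 := Int.floor_le (x - y)
  have h2 := Int.lt_floor_add_one (x - y)
  have h3 := F.monotone (show y + (⌊x - y⌋ : ℤ) ≤ x by linarith)
  have h4 := F.monotone (show x ≤ y + ((⌊x - y⌋ + 1 : ℤ) : ℝ) by push_cast; linarith)
  rw [F.map_add_int] at h3 h4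
  push_cast at h4
  rw [abs_le]
  constructor <;> linarith

/-- A lift commuting with `x ↦ x + 1 / k` descends to the quotient by this translation. -/
lemma exists_unit_scale {k : ℕ} (hk : 1 ≤ k) (F : CircleDeg1Liftˣ)
    (h : ∀ x, F (x + 1 / k) = F x + 1 / k) : ∃ Φ : CircleDeg1Liftˣ, ∀ x, Φ (k * x) = k * F x := by
  have hk0 : (0 : ℝ) < k := by exact_mod_cast hk
  let Φ : CircleDeg1Lift := ⟨⟨fun y => k * F (y / k), fun y z hyz => by
    have := (unit_strictMono F).monotone (div_le_div_of_nonneg_right hyz hk0.le)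
    dsimp only
    gcongr⟩, fun y => by
    change k * F ((y + 1) / k) = k * F (y / k) + 1
    rw [add_div, h]
    field_simp⟩
  have hΦ : ∀ x, Φ (k * x) = k * F x := fun x => by
    change k * F (k * x / k) = _
    rw [mul_div_cancel_left₀ _ hk0.ne']
  have hb : Function.Bijective Φ := by
    constructor
    · intro y z hyz
      have e1 := hΦ (y / k)
      have e2 := hΦ (z / k)
      rw [mul_div_cancel₀ _ hk0.ne'] at e1 e2
      rw [e1, e2] at hyz
      have := (unit_strictMono F).injective (mul_left_cancel₀ hk0.ne' hyz)
      field_simp at this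
      exact this
    · intro z
      refine ⟨k * (F⁻¹ : CircleDeg1Liftˣ) (z / k), ?_⟩
      rw [hΦ, CircleDeg1Lift.units_apply_inv_apply]
      field_simp
  obtain ⟨u, hu⟩ := CircleDeg1Lift.isUnit_iff_bijective.2 hb
  exact ⟨u, fun x => by rw [hu, hΦ]⟩

/-- The upper adjoint of a monotone degree one map. -/
lemma exists_upper_adjoint {H : CircleDeg1Lift} (hH : Continuous H) :
    ∃ m : CircleDeg1Lift, ∀ x s, H x ≤ s ↔ x ≤ m s := by
  have hs := H.continuous_iff_surjective.1 hH
  have hbdd : ∀ s, BddAbove {x | H x ≤ s} := fun s => by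
    obtain ⟨z, hz⟩ := hs (s + 1)
    refine ⟨z, fun x hx => ?_⟩
    by_contra! h
    have := H.monotone h.le
    have : H x ≤ s := hx
    linarith
  have hg : ∀ x s, H x ≤ s ↔ x ≤ sSup {x | H x ≤ s} := fun x s => by
    refine ⟨fun h => le_csSup (hbdd s) h, fun h => (H.monotone h).trans ?_⟩
    obtain ⟨z, hz⟩ := hs s
    exact (isClosed_le hH continuous_const).csSup_mem ⟨z, hz.le⟩ (hbdd s)
  refine ⟨⟨⟨fun s => sSup {x | H x ≤ s}, fun s t hst => (hg _ _).1 (((hg _ _).2 le_rfl).trans hst)⟩,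
    fun s => eq_of_forall_le_iff fun x => ?_⟩, hg⟩
  change x ≤ sSup {x | H x ≤ s + 1} ↔ x ≤ sSup {x | H x ≤ s} + 1
  have := H.map_sub_nat x 1
  rw [Nat.cast_one] at this
  rw [← hg, ← sub_le_iff_le_add, ← sub_le_iff_le_add (a := x), ← hg, this]

variable {G : Type*} [Group G]

/-- Translation by `1/k` is a deck transformation of the covering, so it is carried to translation
by some `n/k` with `n` constant; `k` repetitions must add up to one, which forces `n = 1`. -/
lemma IsFoldLift.map_add {k : ℕ} (hk : 1 ≤ k) {ψ φ₀ : Rep G} (h : IsFoldLift k ψ φ₀) {g : G}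
    {Ψ : CircleDeg1Liftˣ} (hΨ : IsLift Ψ (act ψ g)) (x : ℝ) :
    Ψ (x + 1 / k) = Ψ x + 1 / k := by
  have hk0 : (k : ℝ) ≠ 0 := by positivity
  have hc := unit_continuous Ψ
  have hcoe : ∀ y : ℝ, ((k * Ψ y : ℝ) : UnitAddCircle) = act φ₀ g ((k * y : ℝ) : UnitAddCircle) :=
    fun y => by
      rw [← nsmul_eq_mul, ← nsmul_eq_mul, AddCircle.coe_nsmul, AddCircle.coe_nsmul, h, hΨ]
  obtain ⟨n, hn⟩ := exists_int_of_coe_eq (f := fun x => k * Ψ (x + 1 / k)) (f' := fun x => k * Ψ x)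
    (by fun_prop) (by fun_prop) fun x => by
      rw [hcoe, hcoe]
      congr 1
      rw [mul_add, mul_one_div_cancel hk0]
      exact_mod_cast coe_add_int _ 1
  have hstep : ∀ y, Ψ (y + 1 / k) = Ψ y + n / k := fun y => by
    have := hn y
    apply mul_left_cancel₀ hk0
    rw [mul_add, mul_div_cancel₀ _ hk0]
    exact this
  have hiter : ∀ i : ℕ, Ψ (x + i / k) = Ψ x + i * (n / k) := fun i => by
    induction i with
    | zero => simp
    | succ i ih =>
      rw [show x + ((i + 1 : ℕ) : ℝ) / k = x + i / k + 1 / k by push_cast; ring, hstep, ih]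
      push_cast
      ring
  have h1 := hiter k
  rw [div_self hk0, CircleDeg1Lift.map_add_one, mul_div_cancel₀ _ hk0] at h1
  rw [hstep, show (n : ℝ) = 1 by linarith]

lemma hasFoldModel_one {φ : Rep G} (hφ : ¬ IsTypeZero φ) : HasFoldModel 1 φ := by
  obtain ⟨ψ, hψ, H, hH⟩ := exists_minimal_intertwines hφ
  exact ⟨ψ, isMinimalModel_of_intertwines hφ hψ hH, ψ, fun g x => by simp⟩

/-- A minimal model that is a `k`-fold lift, in terms of lifts to the line. -/
lemma HasFoldModel.exists_semiconj {k : ℕ} (hk : 1 ≤ k) {φ : Rep G} (h : HasFoldModel k φ) :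
    ∃ H : CircleDeg1Lift, Continuous H ∧ ∀ g (F : CircleDeg1Liftˣ), IsLift F (act φ g) →
      ∃ Ψ : CircleDeg1Liftˣ, (∀ x, Ψ (H x) = H (F x)) ∧ ∀ x, Ψ (x + 1 / k) = Ψ x + 1 / k := by
  obtain ⟨ψ, hψ, φ₀, h₀⟩ := h
  obtain ⟨H, hH⟩ := hψ.exists_intertwines
  have hc := hH.continuous hψ.1
  refine ⟨H, hc, fun g F hF => ?_⟩
  obtain ⟨Ψ, hΨ, he⟩ := hH.exists_lift hc hF
  exact ⟨Ψ, he, h₀.map_add hk hΨ⟩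

/-- Some monotone degree one map semiconjugates the action to translations, up to an error `ε`. -/
def IsAlmostTypeZero (ε : ℝ) (φ : Rep G) : Prop :=
  ∃ H : CircleDeg1Lift, H 0 = 0 ∧ ∀ g (F : CircleDeg1Liftˣ), IsLift F (act φ g) →
    ∀ x y, |(H (F x) - H x) - (H (F y) - H y)| ≤ ε

lemma isAlmostTypeZero_of_map {ε : ℝ} {φ : Rep G} (H : CircleDeg1Lift)
    (h : ∀ g (F : CircleDeg1Liftˣ), IsLift F (act φ g) →
      ∀ x y, |(H (F x) - H x) - (H (F y) - H y)| ≤ ε) : IsAlmostTypeZero ε φ := by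
  refine ⟨CircleDeg1Lift.translate (Multiplicative.ofAdd (-H 0)) * H, ?_, fun g F hF x y => ?_⟩
  · rw [CircleDeg1Lift.mul_apply, CircleDeg1Lift.translate_apply, neg_add_cancel]
  · simp only [CircleDeg1Lift.mul_apply, CircleDeg1Lift.translate_apply, add_sub_add_left_eq_sub]
    exact h g F hF x y

lemma IsTypeZero.isAlmostTypeZero {φ : Rep G} (h : IsTypeZero φ) : IsAlmostTypeZero 0 φ := by
  obtain ⟨μ, hμ, hinv⟩ := h
  refine isAlmostTypeZero_of_map (distribution μ) fun g F hF x y => ?_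
  obtain ⟨c, hc⟩ := exists_distribution_map_sub φ μ (hinv g) hF
  simp [hc]

/-- Rescaling by `k` turns `Ψ` into a degree one lift, whose displacement oscillates by at most one;
scaling back divides this by `k`. -/
lemma HasFoldModel.isAlmostTypeZero {k : ℕ} (hk : 1 ≤ k) {φ : Rep G} (h : HasFoldModel k φ) :
    IsAlmostTypeZero (1 / k) φ := by
  have hk0 : (0 : ℝ) < k := by exact_mod_cast hk
  obtain ⟨H, -, hH⟩ := h.exists_semiconj hk
  refine isAlmostTypeZero_of_map H fun g F hF x y => ?_
  obtain ⟨Ψ, he, hΨ⟩ := hH g F hF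
  obtain ⟨Φ, hΦ⟩ := exists_unit_scale hk Ψ hΨ
  have := abs_displacement_sub_le Φ (k * H x) (k * H y)
  rw [hΦ, hΦ, he, he, ← mul_sub, ← mul_sub, ← mul_sub, abs_mul, abs_of_pos hk0] at this
  rwa [le_div_iff₀ hk0, mul_comm]

/-- A monotone degree one map of the line commuting with the lifts of the action, some orbit of
which advances by one in `k` steps. -/
def IsRoot (k : ℕ) (φ : Rep G) (θ : CircleDeg1Lift) (x : ℝ) : Prop :=
  (∀ g (F : CircleDeg1Liftˣ), IsLift F (act φ g) → ∀ x, θ (F x) = F (θ x)) ∧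
    |θ 0| ≤ 2 ∧ x ∈ Icc (0 : ℝ) 1 ∧ θ^[k] x = x + 1

/-- Translation by `1/k` in the model is lifted through `H` by always choosing the right end `m s`
of the fibre over `s`. This choice is canonical, hence equivariant. -/
lemma HasFoldModel.exists_isRoot {k : ℕ} (hk : 1 ≤ k) {φ : Rep G} (h : HasFoldModel k φ) :
    ∃ θ x, IsRoot k φ θ x := by
  have hk0 : (0 : ℝ) < k := by exact_mod_cast hk
  obtain ⟨H, hc, hH⟩ := h.exists_semiconj hk
  have hs := H.continuous_iff_surjective.1 hc
  obtain ⟨m, hm⟩ := exists_upper_adjoint hc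
  have hHm : ∀ s, H (m s) = s := fun s => by
    refine le_antisymm ((hm _ _).2 le_rfl) ?_
    obtain ⟨z, rfl⟩ := hs s
    exact H.monotone ((hm _ _).1 le_rfl)
  set θ : CircleDeg1Lift := m * (CircleDeg1Lift.translate (Multiplicative.ofAdd (1 / k : ℝ)) * H)
  have hθ : ∀ x, θ x = m (H x + 1 / k) := fun x => by
    rw [CircleDeg1Lift.mul_apply, CircleDeg1Lift.mul_apply, CircleDeg1Lift.translate_apply,
      add_comm]
  have hle : (1 / k : ℝ) ≤ 1 := by
    rw [div_le_one hk0]; exact_mod_cast hk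
  have hiter : ∀ (i : ℕ) s, θ^[i] (m s) = m (s + i / k) := fun i => by
    induction i with
    | zero => simp
    | succ i ih =>
      intro s
      rw [Function.iterate_succ_apply, hθ, hHm, ih]
      congr 1
      push_cast
      ring
  -- The right end `m 0` is shifted by an integer into `[0, 1]`, to stay in a compact set when
  -- limits are taken.
  refine ⟨θ, m (-⌊m 0⌋ : ℤ), fun g F hF x => ?_, ?_, ?_, ?_⟩
  · obtain ⟨Ψ, he, hΨ⟩ := hH g F hF
    rw [hθ, hθ, ← he, ← hΨ]
    generalize H x + 1 / k = s
    refine eq_of_forall_le_iff fun y => ?_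
    rw [← hm]
    have e := CircleDeg1Lift.units_apply_inv_apply F y
    rw [← e, (unit_strictMono F).le_iff_le, ← he, (unit_strictMono Ψ).le_iff_le, hm]
  · have h1 : 0 ≤ θ 0 := by
      rw [hθ, ← hm]
      linarith [one_div_pos.2 hk0]
    have h2 : H (θ 0) = H 0 + 1 / k := by rw [hθ, hHm]
    rw [abs_of_nonneg h1]
    by_contra! h3
    have h4 := H.monotone h3.le
    have h5 := H.map_add_nat 0 2
    norm_num at h5
    linarith
  · have := m.map_int_add (-⌊m 0⌋) 0
    rw [add_zero] at this
    rw [this]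
    push_cast
    constructor
    · linarith [Int.floor_le (m 0)]
    · linarith [Int.lt_floor_add_one (m 0)]
  · rw [hiter, div_self hk0.ne', m.map_add_one]

end

/-! ### Limits of actions and of their monotone maps. -/

section

variable {G : Type*} [Group G]

lemma dist_le_unifDist (f h : HomeoPlus) (x : UnitAddCircle) :
    dist (f.1 x) (h.1 x) ≤ unifDist f h := by
  refine le_ciSup (f := fun x => dist (f.1 x) (h.1 x)) ⟨1 / 2, ?_⟩ x
  rintro _ ⟨y, rfl⟩
  dsimp only
  rw [dist_eq_norm]
  simpa using AddCircle.norm_le_half_period (1 : ℝ) one_ne_zero (x := f.1 y - h.1 y)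

lemma unifDist_self (f : HomeoPlus) : unifDist f f = 0 := by
  simp [unifDist]

lemma eventually_unifDist_lt (φ : Rep G) (g : G) {ε : ℝ} (hε : 0 < ε) :
    ∀ᶠ φ' in 𝓝 φ, unifDist (φ' g) (φ g) < ε :=
  (TopologicalSpace.isOpen_generateFrom_of_mem ⟨φ, g, ε, hε, rfl⟩ : IsOpen (subbasic φ g ε)).mem_nhds
    (by change unifDist (φ g) (φ g) < ε; rwa [unifDist_self])

/-- A continuous function that is near the integers everywhere and small at one point is small. -/
lemma abs_lt_of_near_int {D : ℝ → ℝ} (hD : Continuous D) {ε : ℝ} (hε : ε ≤ 1 / 3)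
    (h : ∀ x, ∃ n : ℤ, |D x - n| < ε) (h0 : |D 0| ≤ 1 / 2) (x : ℝ) : |D x| < ε := by
  have key : ∀ y, |D y| ≤ 1 / 2 → |D y| < ε := fun y hy => by
    obtain ⟨n, hn⟩ := h y
    have h1 : |(n : ℝ)| < 1 := by
      have := abs_sub_abs_le_abs_sub (n : ℝ) (D y)
      rw [abs_sub_comm] at this
      linarith
    have h2 : n = 0 := by
      have : |n| < 1 := by exact_mod_cast h1
      exact Int.abs_lt_one_iff.1 this
    simpa [h2] using hn
  by_contra! hx
  have hx' : 1 / 2 < |D x| := by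
    by_contra! h'
    exact absurd (key x h') (not_lt.2 hx)
  obtain ⟨y, hy⟩ := mem_range_of_exists_le_of_exists_ge hD.abs ⟨0, h0⟩ ⟨x, hx'.le⟩
  have := key y (le_of_eq hy)
  dsimp only at hy
  linarith

/-- Lifts can be chosen to depend continuously on the action. -/
lemma exists_lift_near (φ : Rep G) {g : G} {F : CircleDeg1Liftˣ} (hF : IsLift F (act φ g)) :
    ∃ F' : Rep G → CircleDeg1Liftˣ, (∀ φ', IsLift (F' φ') (act φ' g)) ∧
      ∀ δ > 0, ∀ᶠ φ' in 𝓝 φ, ∀ x, |F' φ' x - F x| ≤ δ := by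
  have : ∀ φ' : Rep G, ∃ F' : CircleDeg1Liftˣ, IsLift F' (act φ' g) ∧ |F' 0 - F 0| ≤ 1 / 2 := by
    intro φ'
    obtain ⟨F₀, hF₀⟩ := exists_lift φ' g
    refine ⟨CircleDeg1Lift.translate (Multiplicative.ofAdd (round (F 0 - F₀ 0) : ℝ)) * F₀,
      fun x => ?_, ?_⟩
    · rw [Units.val_mul, CircleDeg1Lift.mul_apply, CircleDeg1Lift.translate_apply, add_comm,
        coe_add_int, hF₀]
    · rw [Units.val_mul, CircleDeg1Lift.mul_apply, CircleDeg1Lift.translate_apply, abs_sub_comm,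
        add_comm, ← sub_sub]
      exact abs_sub_round _
  choose F' hF' h0 using this
  refine ⟨F', hF', fun δ hδ => ?_⟩
  filter_upwards [eventually_unifDist_lt φ g (lt_min hδ (show (0 : ℝ) < 1 / 3 by norm_num))]
    with φ' hφ' x
  have hε := min_le_right δ (1 / 3)
  refine (abs_lt_of_near_int ((unit_continuous (F' φ')).sub (unit_continuous F)) hε (fun y => ?_)
    (h0 φ') x).le.trans (min_le_left _ _)
  refine ⟨round (F' φ' y - F y), ?_⟩
  have h1 := (dist_le_unifDist (φ' g) (φ g) y).trans_lt hφ'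
  change dist (act φ' g y) (act φ g y) < _ at h1
  rw [← hF' φ' y, ← hF y, dist_eq_norm, ← AddCircle.coe_sub, UnitAddCircle.norm_eq] at h1
  exact h1

lemma exists_tendsto_of_bounded {α : Type*} (l : Ultrafilter α) {f : α → ℝ} {a b : ℝ}
    (h : ∀ᶠ x in l, f x ∈ Icc a b) : ∃ y ∈ Icc a b, Tendsto f l (𝓝 y) := by
  obtain ⟨y, hy, hl⟩ := isCompact_Icc.ultrafilter_le_nhds (l.map f) (le_principal_iff.2 h)
  exact ⟨y, hy, hl⟩

/-- Monotone degree one maps are compact for pointwise convergence, up to translation. -/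
lemma exists_pointwise_limit {α : Type*} (l : Ultrafilter α) (T : α → CircleDeg1Lift) {C : ℝ}
    (h : ∀ᶠ a in l, |T a 0| ≤ C) :
    ∃ S : CircleDeg1Lift, ∀ x, Tendsto (fun a => T a x) l (𝓝 (S x)) := by
  have : ∀ x, ∃ y, Tendsto (fun a => T a x) l (𝓝 y) := fun x => by
    obtain ⟨y, -, hy⟩ := exists_tendsto_of_bounded l (f := fun a => T a x)
      (a := -C + ⌊x⌋) (b := C + ⌈x⌉) (by
        filter_upwards [h] with a ha
        have h1 := (T a).map_le_of_map_zero x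
        have h2 := (T a).le_map_of_map_zero x
        rw [abs_le] at ha
        constructor <;> linarith)
    exact ⟨y, hy⟩
  choose S hS using this
  refine ⟨⟨⟨S, fun x y hxy => ?_⟩, fun x => ?_⟩, hS⟩
  · exact le_of_tendsto_of_tendsto' (hS x) (hS y) fun a => (T a).monotone hxy
  · refine tendsto_nhds_unique (hS (x + 1)) ?_
    simpa using (hS x).add_const 1

/-- A limit of actions that are type zero up to errors tending to zero is of type zero. -/
lemma isTypeZero_of_tendsto {φ : Rep G} (l : Ultrafilter (Rep G)) (hl : (l : Filter (Rep G)) ≤ 𝓝 φ)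
    {ε : Rep G → ℝ} (hε : Tendsto ε l (𝓝 0)) (h : ∀ᶠ φ' in l, IsAlmostTypeZero (ε φ') φ') :
    IsTypeZero φ := by
  have : ∃ H' : Rep G → CircleDeg1Lift, ∀ᶠ φ' in l, H' φ' 0 = 0 ∧
      ∀ g (F : CircleDeg1Liftˣ), IsLift F (act φ' g) →
        ∀ x y, |(H' φ' (F x) - H' φ' x) - (H' φ' (F y) - H' φ' y)| ≤ ε φ' := by
    obtain ⟨f, hf⟩ := h.choice
    exact ⟨f, hf⟩
  obtain ⟨H', hH'⟩ := this
  obtain ⟨H, hH⟩ := exists_pointwise_limit l H' (C := 0) (hH'.mono fun φ' h => by simp [h.1])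
  refine isTypeZero_of_monotone φ H fun g => ?_
  obtain ⟨F, hF⟩ := exists_lift φ g
  obtain ⟨F', hF', hnear⟩ := exists_lift_near φ hF
  obtain ⟨c, -, hc⟩ := exists_tendsto_of_bounded l (f := fun φ' => H' φ' (F' φ' 0))
    (a := F 0 - 2) (b := F 0 + 2) (by
      filter_upwards [hH', hl (hnear 1 one_pos)] with φ' h1 h2
      have h3 := abs_le.1 (h2 0)
      have h4 := (H' φ').map_le_of_map_zero (F' φ' 0)
      have h5 := (H' φ').le_map_of_map_zero (F' φ' 0)
      rw [h1.1] at h4 h5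
      have := Int.ceil_lt_add_one (F' φ' 0)
      have := Int.lt_floor_add_one (F' φ' 0)
      constructor <;> linarith)
  refine ⟨F, hF, c, fun x y hxy => ?_⟩
  -- The margin `F y - F x` absorbs the error of the nearby lift: eventually `F x ≤ F' φ' y` and `F'
  -- φ' x ≤ F y`.
  have hev := hH'.and (hl (hnear (F y - F x) (sub_pos.2 (unit_strictMono F hxy))))
  constructor
  · have h1 := ((hH y).add hc).add hε
    rw [add_zero] at h1
    refine le_of_tendsto_of_tendsto (hH (F x)) h1 ?_
    filter_upwards [hev] with φ' ⟨⟨h0, h2⟩, h3⟩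
    have h4 := (H' φ').monotone (show F x ≤ F' φ' y by linarith [abs_le.1 (h3 y)])
    have h5 := abs_le.1 (h2 g _ (hF' φ') y 0)
    rw [h0] at h5
    linarith
  · have h1 := (hH (F y)).add hε
    rw [add_zero] at h1
    refine le_of_tendsto_of_tendsto ((hH x).add hc) h1 ?_
    filter_upwards [hev] with φ' ⟨⟨h0, h2⟩, h3⟩
    have h4 := (H' φ').monotone (show F' φ' x ≤ F y by linarith [abs_le.1 (h3 x)])
    have h5 := abs_le.1 (h2 g _ (hF' φ') x 0)
    rw [h0] at h5
    linarith

/-- A map weakly commuting with an action induces a map commuting with a minimal quotient. -/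
lemma exists_induced {φ ψ : Rep G} (hψ : IsMinimal ψ) {H : CircleDeg1Lift} (hH : Intertwines H φ ψ)
    (θ : CircleDeg1Lift)
    (hθ : ∀ g (F : CircleDeg1Liftˣ), IsLift F (act φ g) → ∀ x y, x < y →
      θ (F x) ≤ F (θ y) ∧ F (θ x) ≤ θ (F y)) :
    ∃ T : CircleDeg1Lift, Continuous T ∧ (∀ x, H (θ x) = T (H x)) ∧
      ∀ g, ∃ Ψ : CircleDeg1Liftˣ, IsLift Ψ (act ψ g) ∧ ∀ y, T (Ψ y) = Ψ (T y) := by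
  have hc := hH.continuous hψ
  have hs := H.continuous_iff_surjective.1 hc
  -- The supremum runs over points strictly to the left of the fibre over `y`. The room this leaves
  -- turns weak commutation into exact commutation.
  let A : ℝ → Set ℝ := fun y => (fun x => H (θ x)) '' {x | H x < y}
  have hne : ∀ y, (A y).Nonempty := fun y => by
    obtain ⟨x, hx⟩ := hs (y - 1)
    exact ⟨_, x, by change H x < y; linarith, rfl⟩
  have hlt : ∀ {x z}, H x < H z → x < z := fun h => H.monotone.reflect_lt h
  have hbdd : ∀ y, BddAbove (A y) := fun y => by
    obtain ⟨z, rfl⟩ := hs y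
    refine ⟨H (θ z), ?_⟩
    rintro _ ⟨x, hx, rfl⟩
    exact H.monotone (θ.monotone (hlt hx).le)
  have hmem : ∀ {x y}, H x < y → H (θ x) ≤ sSup (A y) := fun {x y} h =>
    le_csSup (hbdd y) ⟨x, h, rfl⟩
  have hle : ∀ {y b}, (∀ x, H x < y → H (θ x) ≤ b) → sSup (A y) ≤ b := fun {y b} h =>
    csSup_le (hne y) (by rintro _ ⟨x, hx, rfl⟩; exact h x hx)
  have hsub : ∀ (S : CircleDeg1Lift) x, S (x - 1) = S x - 1 := fun S x => by
    simpa using S.map_sub_nat x 1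
  let T : CircleDeg1Lift := ⟨⟨fun y => sSup (A y), fun y z hyz =>
    hle fun x hx => hmem (hx.trans_le hyz)⟩, fun y => by
      apply le_antisymm
      · refine hle fun x hx => ?_
        have := hmem (show H (x - 1) < y by rw [hsub]; linarith)
        rw [hsub, hsub] at this
        linarith
      · rw [← le_sub_iff_add_le]
        refine hle fun x hx => ?_
        have := hmem (show H (x + 1) < y + 1 by rw [H.map_add_one]; linarith)
        rw [θ.map_add_one, H.map_add_one] at this
        change _ ≤ sSup (A (y + 1)) - 1
        linarith⟩
  have hTmem : ∀ {x y}, H x < y → H (θ x) ≤ T y := hmem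
  have hTle : ∀ {y b}, (∀ x, H x < y → H (θ x) ≤ b) → T y ≤ b := hle
  have hcomm : ∀ g, ∃ Ψ : CircleDeg1Liftˣ, IsLift Ψ (act ψ g) ∧ ∀ y, T (Ψ y) = Ψ (T y) := by
    intro g
    obtain ⟨F, hF⟩ := exists_lift φ g
    obtain ⟨Ψ, hΨ, he⟩ := hH.exists_lift hc hF
    have hbetween : ∀ {x y}, H x < y → ∃ x', x < x' ∧ H x' < y := fun {x y} hxy => by
      obtain ⟨w, hw, hwy⟩ := exists_between hxy
      obtain ⟨x', rfl⟩ := hs w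
      exact ⟨x', hlt hw, hwy⟩
    refine ⟨Ψ, hΨ, fun y => le_antisymm ?_ ?_⟩
    · refine hTle fun z hz => ?_
      have hz' := CircleDeg1Lift.units_apply_inv_apply F z
      set x := (F⁻¹ : CircleDeg1Liftˣ) z
      rw [← hz', ← he, (unit_strictMono Ψ).lt_iff_lt] at hz
      obtain ⟨x', hxx', hx'⟩ := hbetween hz
      rw [← hz']
      refine (H.monotone (hθ g F hF x x' hxx').1).trans ?_
      rw [← he]
      exact (unit_strictMono Ψ).monotone (hTmem hx')
    · have e := CircleDeg1Lift.units_apply_inv_apply Ψ (T (Ψ y))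
      rw [← e, (unit_strictMono Ψ).le_iff_le]
      refine hTle fun x hx => ?_
      rw [← (unit_strictMono Ψ).le_iff_le, e, he]
      obtain ⟨x', hxx', hx'⟩ := hbetween hx
      refine (H.monotone (hθ g F hF x x' hxx').2).trans (hTmem ?_)
      rw [← he]
      exact unit_strictMono Ψ hx'
  have hT : Continuous T := continuous_of_isMinimal (φ := ψ) hψ T fun g => by
    obtain ⟨Ψ, hΨ, hy⟩ := hcomm g
    exact ⟨Ψ, Ψ, hΨ, hΨ, fun y => by rw [hy]⟩
  refine ⟨T, hT, fun x => le_antisymm ?_ (hTle fun z hz => H.monotone (θ.monotone (hlt hz).le)),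
    hcomm⟩
  refine ge_of_tendsto ((hT.tendsto (H x)).mono_left nhdsWithin_le_nhds :
    Tendsto T (𝓝[>] (H x)) (𝓝 (T (H x)))) ?_
  filter_upwards [self_mem_nhdsWithin] with y hy using hTmem hy

end

/-! ### Recovering a fold model in the limit, and closedness. -/

section

variable {G : Type*} [Group G]

/-- For a minimal action, a commuting map with a point advancing by one in `k` steps has all points
advancing by one in `k` steps. -/
lemma iterate_eq_of_isMinimal {ψ : Rep G} (hψ : IsMinimal ψ) {T : CircleDeg1Lift}
    (hT : Continuous T)
    (hcomm : ∀ g, ∃ Ψ : CircleDeg1Liftˣ, IsLift Ψ (act ψ g) ∧ ∀ y, T (Ψ y) = Ψ (T y))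
    {k : ℕ} {y : ℝ} (hy : T^[k] y = y + 1) (z : ℝ) : T^[k] z = z + 1 := by
  have hcl : IsClosed {z | T^[k] z = z + 1} :=
    isClosed_eq (hT.iterate k) (continuous_id.add_const 1)
  have hd : Dense (((↑) : ℝ → UnitAddCircle) ⁻¹' range fun g => act ψ g y) :=
    (hψ _).preimage QuotientAddGroup.isOpenMap_coe
  refine hcl.closure_subset_iff.2 ?_ (hd z)
  rintro w ⟨g, hg⟩
  obtain ⟨Ψ, hΨ, hc⟩ := hcomm g
  dsimp only at hg
  rw [← hΨ, eq_comm, coe_eq_coe_iff] at hg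
  obtain ⟨n, rfl⟩ := hg
  have h1 : T^[k] (Ψ y + n) = T^[k] (Ψ y) + n := by
    rw [← CircleDeg1Lift.coe_pow, CircleDeg1Lift.map_add_int]
  have h2 : T^[k] (Ψ y) = Ψ (T^[k] y) :=
    (Function.Commute.iterate_left (f := T) (g := Ψ) hc k) y
  change T^[k] (Ψ y + n) = Ψ y + n + 1
  rw [h1, h2, hy, CircleDeg1Lift.map_add_one]
  ring

/-- A map of order `k` modulo `x ↦ x + 1` is conjugate to the translation by `1 / k`. -/
lemma exists_unit_conj {T : CircleDeg1Lift} (hT : Continuous T) {k : ℕ} (hk : 1 ≤ k)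
    (h : ∀ y, T^[k] y = y + 1) :
    ∃ S : CircleDeg1Liftˣ, ∀ y, S (T y) = S y + 1 / k := by
  have hk0 : (0 : ℝ) < k := by exact_mod_cast hk
  have hiter : ∀ i : ℕ, Monotone T^[i] := fun i => T.monotone.iterate i
  let s : ℝ → ℝ := fun y => (∑ i ∈ Finset.range k, T^[i] y) / k
  have hs : StrictMono s := fun y z hyz => by
    refine div_lt_div_of_pos_right ?_ hk0
    exact Finset.sum_lt_sum (fun i _ => hiter i hyz.le) ⟨0, Finset.mem_range.2 hk, hyz⟩
  let S : CircleDeg1Lift := ⟨⟨s, hs.monotone⟩, fun y => by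
    have : ∀ i : ℕ, T^[i] (y + 1) = T^[i] y + 1 := fun i => by
      rw [← CircleDeg1Lift.coe_pow, CircleDeg1Lift.map_add_one]
    simp only [s, this, Finset.sum_add_distrib]
    rw [add_div]
    simp [hk0.ne']⟩
  have hc : Continuous s :=
    (continuous_finsetSum _ fun i _ => hT.iterate i).div_const _
  obtain ⟨u, hu⟩ := CircleDeg1Lift.isUnit_iff_bijective.2
    (⟨hs.injective, S.continuous_iff_surjective.1 hc⟩ : Function.Bijective S)
  refine ⟨u, fun y => ?_⟩
  rw [hu]
  change (∑ i ∈ Finset.range k, T^[i] (T y)) / k = (∑ i ∈ Finset.range k, T^[i] y) / k + 1 / k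
  rw [← add_div]
  congr 1
  -- Applying `T` shifts the orbit sum by one index, so it changes by `T^[k] y - y = 1`.
  have h1 := Finset.sum_range_succ (fun i => T^[i] y) k
  have h2 := Finset.sum_range_succ' (fun i => T^[i] y) k
  simp only [Function.iterate_succ_apply, Function.iterate_zero, id] at h2
  rw [h] at h1
  linarith

lemma hasFoldModel_of_commute {φ ψ : Rep G} (hφ : ¬ IsTypeZero φ) (hψ : IsMinimal ψ)
    {H : CircleDeg1Lift} (hH : Intertwines H φ ψ) {T : CircleDeg1Lift} (hT : Continuous T)
    (hcomm : ∀ g, ∃ Ψ : CircleDeg1Liftˣ, IsLift Ψ (act ψ g) ∧ ∀ y, T (Ψ y) = Ψ (T y))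
    {k : ℕ} (hk : 1 ≤ k) {y : ℝ} (hy : T^[k] y = y + 1) : HasFoldModel k φ := by
  have hk0 : (k : ℝ) ≠ 0 := by positivity
  obtain ⟨S, hS⟩ := exists_unit_conj hT hk (iterate_eq_of_isMinimal hψ hT hcomm hy)
  choose Ψ hΨ hc using hcomm
  have hs : Function.Surjective (circleMap S) :=
    circleMap_surjective (CircleDeg1Lift.toOrderIso S).surjective
  obtain ⟨ψ', hΨ', hψ'⟩ := exists_rep_of_semiconj ψ hs (fun g => S * Ψ g * S⁻¹) fun g p => by
    obtain ⟨x, rfl⟩ := coe_surj p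
    rw [circleMap_coe, circleMap_coe, ← hΨ, circleMap_coe]
    simp
  have hmin : IsMinimal ψ' := fun q => by
    obtain ⟨p, rfl⟩ := hs q
    refine (hs.denseRange.dense_image (continuous_circleMap (unit_continuous S)) (hψ p)).mono ?_
    rintro _ ⟨_, ⟨g, rfl⟩, rfl⟩
    exact ⟨g, hψ' g p⟩
  have hadd : ∀ g x, (S * Ψ g * S⁻¹ : CircleDeg1Liftˣ) (x + 1 / k) =
      (S * Ψ g * S⁻¹ : CircleDeg1Liftˣ) x + 1 / k := fun g x => by
    obtain ⟨z, rfl⟩ := (CircleDeg1Lift.toOrderIso S).surjective x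
    simp only [CircleDeg1Lift.coe_toOrderIso]
    rw [← hS]
    simp only [Units.val_mul, CircleDeg1Lift.mul_apply, CircleDeg1Lift.units_inv_apply_apply]
    rw [← hc, hS]
  choose Φ hΦ using fun g => exists_unit_scale hk _ (hadd g)
  have hcoe : ∀ x : ℝ, ((k * x : ℝ) : UnitAddCircle) = k • (x : UnitAddCircle) := fun x => by
    rw [← nsmul_eq_mul, AddCircle.coe_nsmul]
  obtain ⟨φ₀, -, h₀⟩ := exists_rep_of_semiconj ψ' (p := fun x => k • x) (fun q => by
    obtain ⟨x, rfl⟩ := coe_surj q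
    exact ⟨((x / k : ℝ) : UnitAddCircle), by
      dsimp only
      rw [← hcoe, mul_div_cancel₀ _ hk0]⟩) Φ fun g p => by
    obtain ⟨x, rfl⟩ := coe_surj p
    rw [← hcoe, circleMap_coe, hΦ, hcoe, hΨ']
  have hHS : Intertwines (S * H) φ ψ' := hH.comp fun g p => hψ' g p
  exact ⟨ψ', isMinimalModel_of_intertwines hφ hmin hHS, φ₀, h₀⟩

/-- Having a `k`-fold model is a closed condition on the actions that are not of type zero. -/
lemma hasFoldModel_of_eventually {φ : Rep G} (hφ : ¬ IsTypeZero φ) (l : Ultrafilter (Rep G))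
    (hl : (l : Filter (Rep G)) ≤ 𝓝 φ) {k : ℕ} (hk : 1 ≤ k) (h : ∀ᶠ φ' : Rep G in l, HasFoldModel k φ') :
    HasFoldModel k φ := by
  obtain ⟨θ', h⟩ := (h.mono fun φ' h => h.exists_isRoot hk).choice
  obtain ⟨x', h⟩ := h.choice
  obtain ⟨θ, hθ⟩ := exists_pointwise_limit l θ' (h.mono fun φ' h => h.2.1)
  obtain ⟨x, -, hx⟩ := exists_tendsto_of_bounded l (h.mono fun φ' h => h.2.2.1)
  obtain ⟨ψ, hψ, H, hH⟩ := exists_minimal_intertwines hφ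
  have hc := hH.continuous hψ
  have hs := H.continuous_iff_surjective.1 hc
  obtain ⟨T, hT, hHT, hcomm⟩ := exists_induced hψ hH θ fun g F hF x y hxy => by
    obtain ⟨F', hF', hnear⟩ := exists_lift_near φ hF
    constructor
    · refine le_of_forall_pos_le_add fun δ hδ => ?_
      refine le_of_tendsto_of_tendsto (hθ (F x))
        ((((unit_continuous F).tendsto _).comp (hθ y)).add_const δ) ?_
      filter_upwards [h, hl (hnear δ hδ), hl (hnear (F y - F x) (sub_pos.2 (unit_strictMono F hxy)))]
        with φ' h1 h2 h3
      have h4 := (θ' φ').monotone (show F x ≤ F' φ' y by linarith [abs_le.1 (h3 y)])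
      rw [h1.1 g _ (hF' φ')] at h4
      dsimp only [Function.comp]
      linarith [abs_le.1 (h2 (θ' φ' y))]
    · refine le_of_forall_pos_le_add fun δ hδ => ?_
      refine le_of_tendsto_of_tendsto (((unit_continuous F).tendsto _).comp (hθ x))
        ((hθ (F y)).add_const δ) ?_
      filter_upwards [h, hl (hnear δ hδ), hl (hnear (F y - F x) (sub_pos.2 (unit_strictMono F hxy)))]
        with φ' h1 h2 h3
      have h4 := (θ' φ').monotone (show F' φ' x ≤ F y by linarith [abs_le.1 (h3 x)])
      rw [h1.1 g _ (hF' φ')] at h4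
      dsimp only [Function.comp]
      linarith [abs_le.1 (h2 (θ' φ' x))]
  -- The maps `θ'` converge only pointwise, while the base points move with `φ'`. Monotonicity and
  -- continuity of `T` give a squeeze between fixed points on either side, so the images under `H`
  -- converge.
  have hstep : ∀ (u : Rep G → ℝ) (y : ℝ), Tendsto (fun φ' => H (u φ')) l (𝓝 y) →
      Tendsto (fun φ' => H (θ' φ' (u φ'))) l (𝓝 (T y)) := by
    intro u y hu
    have hlim : ∀ a, Tendsto (fun φ' => H (θ' φ' a)) l (𝓝 (T (H a))) := fun a => by
      rw [← hHT]
      exact (hc.tendsto _).comp (hθ a)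
    rw [tendsto_order]
    constructor
    · intro b hb
      obtain ⟨z, hzy, hz⟩ :=
        (((hT.tendsto y).mono_left nhdsWithin_le_nhds).eventually_const_lt hb |>.and
          (self_mem_nhdsWithin : Iio y ∈ 𝓝[<] y)).exists
      obtain ⟨a, rfl⟩ := hs z
      filter_upwards [(hlim a).eventually_const_lt hzy, hu.eventually_const_lt hz] with φ' h1 h2
      exact h1.trans_le (H.monotone ((θ' φ').monotone (H.monotone.reflect_lt h2).le))
    · intro b hb
      obtain ⟨z, hzy, hz⟩ :=
        (((hT.tendsto y).mono_left nhdsWithin_le_nhds).eventually_lt_const hb |>.and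
          (self_mem_nhdsWithin : Ioi y ∈ 𝓝[>] y)).exists
      obtain ⟨a, rfl⟩ := hs z
      filter_upwards [(hlim a).eventually_lt_const hzy, hu.eventually_lt_const hz] with φ' h1 h2
      exact (H.monotone ((θ' φ').monotone (H.monotone.reflect_lt h2).le)).trans_lt h1
  have hx0 : Tendsto (fun φ' => H (x' φ')) l (𝓝 (H x)) := (hc.tendsto _).comp hx
  have hiter : ∀ i : ℕ, Tendsto (fun φ' => H ((θ' φ')^[i] (x' φ'))) l (𝓝 (T^[i] (H x))) := by
    intro i
    induction i with
    | zero => exact hx0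
    | succ i ih =>
      simp only [Function.iterate_succ_apply']
      exact hstep _ _ ih
  refine hasFoldModel_of_commute hφ hψ hH hT hcomm hk (y := H x) ?_
  refine tendsto_nhds_unique (hiter k) ((hx0.add_const 1).congr' ?_)
  filter_upwards [h] with φ' h1
  rw [h1.2.2.2, H.map_add_one]

/-- Being of type zero or having a `j`-fold model with `j > k` is a closed condition. -/
lemma isClosed_typeZero_or_hasFoldModel (k : ℕ) :
    IsClosed {φ : Rep G | IsTypeZero φ ∨ ∃ j, k < j ∧ HasFoldModel j φ} := by
  rw [isClosed_iff_ultrafilter]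
  intro φ l hl hmem
  by_contra hφ
  simp only [mem_ofPred_eq, not_or, not_exists, not_and] at hφ
  obtain ⟨hφ0, hφj⟩ := hφ
  have hmem : ∀ᶠ φ' : Rep G in l, IsTypeZero φ' ∨ ∃ j, k < j ∧ HasFoldModel j φ' := hmem
  rcases Ultrafilter.eventually_or.1 hmem with h0 | h1
  · exact hφ0 (isTypeZero_of_tendsto l hl (ε := fun _ => 0) tendsto_const_nhds
      (h0.mono fun φ' h => h.isAlmostTypeZero))
  · obtain ⟨j, hj⟩ := h1.choice
    -- Either the multiplicities are unbounded along the ultrafilter and the errors `1/j` vanish, or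
    -- they are bounded on a large set and hence eventually constant.
    by_cases hlim : Tendsto j l atTop
    · refine hφ0 (isTypeZero_of_tendsto l hl (ε := fun φ' => 1 / (j φ' : ℝ)) ?_
        (hj.mono fun φ' h => h.2.isAlmostTypeZero (by omega)))
      exact tendsto_one_div_atTop_nhds_zero_nat.comp hlim
    · rw [tendsto_atTop] at hlim
      push Not at hlim
      obtain ⟨N, hN⟩ := hlim
      have hN : ∀ᶠ φ' in l, ∃ i ∈ Finset.range N, j φ' = i := by
        filter_upwards [hN] with φ' h
        exact ⟨_, Finset.mem_range.2 h, rfl⟩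
      obtain ⟨i, hi⟩ : ∃ i, ∀ᶠ φ' in l, j φ' = i := by
        by_contra! hno
        have : ∀ᶠ φ' in l, ∀ i ∈ Finset.range N, j φ' ≠ i :=
          (Filter.eventually_all_finset _).2 fun i _ => hno i
        obtain ⟨φ', ⟨i, hi, h⟩, h'⟩ := (hN.and this).exists
        exact h' i hi h
      have hev : ∀ᶠ φ' : Rep G in l, k < i ∧ HasFoldModel i φ' := by
        filter_upwards [hj, hi] with φ' h h'
        rwa [h'] at h
      have hki : k < i := hev.exists.choose_spec.1
      exact hφj i hki (hasFoldModel_of_eventually hφ0 l hl (by omega) (hev.mono fun _ h => h.2))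

lemma isClosed_typeZero : IsClosed {φ : Rep G | IsTypeZero φ} := by
  rw [isClosed_iff_ultrafilter]
  intro φ l hl hmem
  exact isTypeZero_of_tendsto l hl (ε := fun _ => 0) tendsto_const_nhds
    ((show ∀ᶠ φ' : Rep G in l, IsTypeZero φ' from hmem).mono fun φ' h => h.isAlmostTypeZero)

lemma iUnion_typeSet_eq (k : ℕ) :
    (⋃ i ∈ Icc 1 k, typeSet G i) =
      {φ : Rep G | IsTypeZero φ ∨ ∃ j, k < j ∧ HasFoldModel j φ}ᶜ := by
  ext φ
  simp only [mem_iUnion, mem_compl_iff, mem_ofPred_eq, not_or, not_exists, not_and]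
  constructor
  · rintro ⟨i, hi, hφ⟩
    obtain ⟨i, rfl⟩ : ∃ m, i = m + 1 := ⟨i - 1, by have := hi.1; omega⟩
    obtain ⟨h0, -, hub⟩ := hφ
    refine ⟨h0, fun j hj hm => ?_⟩
    have := hub ⟨by omega, hm⟩
    have := hi.2
    omega
  · rintro ⟨h0, hj⟩
    have hbdd : ∀ j ∈ {j : ℕ | 1 ≤ j ∧ HasFoldModel j φ}, j ≤ k := fun j h => by
      by_contra! hk
      exact hj j hk h.2
    have hne : {j : ℕ | 1 ≤ j ∧ HasFoldModel j φ}.Nonempty := ⟨1, le_rfl, hasFoldModel_one h0⟩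
    have hmem := Nat.sSup_mem hne ⟨k, hbdd⟩
    have hub : IsGreatest {j : ℕ | 1 ≤ j ∧ HasFoldModel j φ}
      (sSup {j : ℕ | 1 ≤ j ∧ HasFoldModel j φ}) := ⟨hmem, fun j h => le_csSup ⟨k, hbdd⟩ h⟩
    set i := sSup {j : ℕ | 1 ≤ j ∧ HasFoldModel j φ}
    refine ⟨i, ⟨hmem.1, hbdd i hmem⟩, ?_⟩
    obtain ⟨m, hm⟩ : ∃ m, i = m + 1 := ⟨i - 1, by have := hmem.1; omega⟩
    rw [hm] at hub ⊢
    exact ⟨h0, hub⟩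

end

end CircleAction

theorem mainTheorem4 (G : Type*) [Group G] (k : ℕ) (hk : 1 ≤ k) :
    IsClosed (CircleAction.typeSet G 0) ∧
      IsOpen (⋃ i ∈ Set.Icc 1 k, CircleAction.typeSet G i) := by
  refine ⟨CircleAction.isClosed_typeZero, ?_⟩
  rw [CircleAction.iUnion_typeSet_eq]
  exact (CircleAction.isClosed_typeZero_or_hasFoldModel k).isOpen_compl
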